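/- Let $n\ge 1$ and let $1<p<q$ be real numbers. A convex body in $\mathbb{R}^n$ is a compact convex set with non-empty interior; it is centered if $\mathbb{E}[X]=0$ for $X$ uniformly distributed on it. For a centered convex body $K\subset\mathbb{R}^n$ and $X\sim\mathrm{Uni}(K)$ put $$\alpha(K)=\max_{\theta\in S^{n-1}}\frac{\lVert X\cdot\theta\rVert_q}{\lVert X\cdot\theta\rVert_p},\qquad \lVert Y\rVert_r=(\mathbb{E}|Y|^r)^{1/r}.$$ Let $\Delta_n\subset\mathbb{R}^n$ be any centered $n$-dimensional simplex (the convex hull of $n+1$ affinely independent points), and let $K\subset\mathbb{R}^n$ be any centered convex body. Then the maxima defining $\alpha(K)$ and $\alpha(\Delta_n)$ are attained, and $$\alpha(K)\le\alpha(\Delta_n).$$ Moreover, let $\theta_1,\theta_2$ be the outer unit normals of any two distinct facets of $\Delta_n$, let $\Gamma_n\sim\mathrm{Uni}(\Delta_n)$, and put $$\Gamma_n^s=\frac{s\theta_1-(1-s)\theta_2}{|s\theta_1-(1-s)\theta_2|}\cdot\Gamma_n,\qquad 0\le s\le 1.$$ Then $\lVert\Gamma_n^s\rVert_q/\lVert\Gamma_n^s\rVert_p=\alpha(\Delta_n)$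 for some $s\in[0,1]$; and whenever $\theta\in S^{n-1}$ satisfies $\lVert X\cdot\theta\rVert_q/\lVert X\cdot\theta\rVert_p=\alpha(\Delta_n)$, where $X\sim\mathrm{Uni}(K)$, there are $s\in[0,1]$ and $c>0$ such that $X\cdot\theta$ has the same law as $c\,\Gamma_n^s$. -/

import Mathlib

open MeasureTheory ProbabilityTheory

/-- A convex body in `ℝⁿ`: a compact convex set with non-empty interior. -/
structure IsConvexBody {n : ℕ} (K : Set (EuclideanSpace ℝ (Fin n))) : Prop where
  convex : Convex ℝ K
  isCompact : IsCompact K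
  nonempty_interior : (interior K).Nonempty

/-- The uniform distribution on `K`: Lebesgue measure restricted to `K`, normalized. -/
noncomputable def uniformLaw {n : ℕ} (K : Set (EuclideanSpace ℝ (Fin n))) :
    Measure (EuclideanSpace ℝ (Fin n)) :=
  ProbabilityTheory.cond volume K

/-- `K` is centered: a random vector uniform on `K` has mean zero. -/
def IsCentered {n : ℕ} (K : Set (EuclideanSpace ℝ (Fin n))) : Prop :=
  ∫ x, x ∂(uniformLaw K) = 0

/-- The law of the marginal `X · θ`, where `X` is uniform on `K`. -/
noncomputable def marginalLaw {n : ℕ} (K : Set (EuclideanSpace ℝ (Fin n)))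
    (θ : EuclideanSpace ℝ (Fin n)) : Measure ℝ :=
  (uniformLaw K).map (fun x => inner ℝ x θ)

/-- The norm ratio `‖X · θ‖_q / ‖X · θ‖_p`, where `X` is uniform on `K`. -/
noncomputable def normRatio {n : ℕ} (p q : ℝ) (K : Set (EuclideanSpace ℝ (Fin n)))
    (θ : EuclideanSpace ℝ (Fin n)) : ℝ :=
  (eLpNorm (fun x => inner ℝ x θ) (ENNReal.ofReal q) (uniformLaw K)).toReal /
    (eLpNorm (fun x => inner ℝ x θ) (ENNReal.ofReal p) (uniformLaw K)).toReal

/-- `α(K)`: the supremum of the norm ratio over all unit directions. -/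
noncomputable def alpha {n : ℕ} (p q : ℝ) (K : Set (EuclideanSpace ℝ (Fin n))) : ℝ :=
  sSup (normRatio p q K '' Metric.sphere 0 1)

/-- The solid simplex spanned by the vertices of `T`. -/
def solidSimplex {n : ℕ} (T : Affine.Simplex ℝ (EuclideanSpace ℝ (Fin n)) n) :
    Set (EuclideanSpace ℝ (Fin n)) :=
  convexHull ℝ (Set.range T.points)

/-- `u` is the outer unit normal to the facet of the simplex opposite to vertex `i`. -/
def IsOuterUnitNormal {n : ℕ} (T : Affine.Simplex ℝ (EuclideanSpace ℝ (Fin n)) n)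
    (i : Fin (n + 1)) (u : EuclideanSpace ℝ (Fin n)) : Prop :=
  ‖u‖ = 1 ∧ ∃ h : ℝ, (∀ j, j ≠ i → inner ℝ (T.points j) u = h) ∧ inner ℝ (T.points i) u < h

/-- The unit vector `(s u - (1 - s) v) / |s u - (1 - s) v|`. -/
noncomputable def interpDirection {n : ℕ} (u v : EuclideanSpace ℝ (Fin n)) (s : ℝ) :
    EuclideanSpace ℝ (Fin n) :=
  ‖s • u - (1 - s) • v‖⁻¹ • (s • u - (1 - s) • v)

/-! Let n ≥ 2, k = n - 1, and let φ be the k-th root of the density of X·θ. By Brunn–Minkowski φ is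
concave where it is positive (`concaveOnPos_sliceRoot`). For the simplex, consider a functional
equal to m on all vertices but two, with m between the two remaining values. Its slices on either
side of height m are homothetic to the slice at m, so the root γ of its density is a tent: convex on
each half-line ending at m (`convexOn_sliceRoot_solidSimplex`). The directions sθ₁ - (1-s)θ₂ are
exactly of this kind.

Split E|X·θ|^p into the moments of the positive and negative parts. The two parameters s and c allow
both of these p-moments to be matched by a tent marginal (`exists_matching_direction`): the
endpoints s = 0 and s = 1, where one side of the tent degenerates, are extremal for the ratio of the
two half-moments (`IsConvexBody.bodyMoment_ratio_le`), and the intermediate value theorem does the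
rest.

After matching, put D = γ^k - φ^k, which has the sign of γ - φ. A concave function crosses a convex
one rarely, so D has few sign changes. Total mass and mean of D vanish, so passing to the stop-loss
transform x ↦ ∫ (t - x)₊ D(t) dt removes two of them. The p-moment of D on the positive half-line is
p(p-1) times the integral of the transform against x^(p-2), so this integral vanishes. The transform
changes sign there at most once, from - to +, and replacing x^(p-2) by x^(q-2) favours the positive
part (`single_crossing`). Hence each half-line q-moment of K is at most that of the tent. Equality
on both sides makes the transform vanish identically, and the laws agree.

The p-norms being equal, the norm ratio of K is dominated by that of a simplex marginal in the
family. Maxima exist by compactness of the sphere. For n = 1 all centered bodies are symmetric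
intervals. -/

/-! ### Prékopa–Leindler and Brunn–Minkowski inequalities -/

section BrunnMinkowski

open scoped ENNReal Pointwise

lemma volume_image_affine_real (a b : ℝ) (s : Set ℝ) :
    volume ((fun x => a * x + b) '' s) = ENNReal.ofReal |a| * volume s := by
  have : (fun x : ℝ => a * x + b) '' s = (fun x => x + b) '' (a • s) := by
    rw [← Set.image_smul, Set.image_image]; rfl
  rw [this, Set.image_add_right, measure_preimage_add_right, Measure.addHaar_smul]
  simp

/-- With a = max A and b = min B, the sets (1-l)A + lb and (1-l)a + lB both lie in C and meet in at
most the point (1-l)a + lb, so their volumes add. -/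
lemma volume_convexCombination_le_of_isCompact {A B C : Set ℝ} (hA : IsCompact A)
    (hB : IsCompact B) (hAn : A.Nonempty) (hBn : B.Nonempty) {l : ℝ} (hl0 : 0 ≤ l) (hl1 : l ≤ 1)
    (hC : ∀ a ∈ A, ∀ b ∈ B, (1 - l) * a + l * b ∈ C) :
    ENNReal.ofReal (1 - l) * volume A + ENNReal.ofReal l * volume B ≤ volume C := by
  obtain ⟨a, haA, ha⟩ := hA.exists_isGreatest hAn
  obtain ⟨b, hbB, hb⟩ := hB.exists_isLeast hBn
  have h1 := volume_image_affine_real (1 - l) (l * b) A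
  have h2 := volume_image_affine_real l ((1 - l) * a) B
  rw [abs_of_nonneg (by linarith)] at h1
  rw [abs_of_nonneg hl0] at h2
  rw [← h1, ← h2, ← measure_union₀]
  · refine measure_mono ?_
    rintro _ (⟨x, hx, rfl⟩ | ⟨x, hx, rfl⟩)
    · exact hC x hx b hbB
    · have := hC a haA x hx
      simpa [add_comm] using this
  · refine IsCompact.measurableSet ?_ |>.nullMeasurableSet
    exact hB.image (by fun_prop)
  · refine measure_mono_null (t := {(1 - l) * a + l * b}) ?_ (by simp)
    rintro _ ⟨⟨x, hx, rfl⟩, ⟨y, hy, hxy⟩⟩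
    have h3 : (1 - l) * x ≤ (1 - l) * a := mul_le_mul_of_nonneg_left (ha hx) (by linarith)
    have h4 : l * b ≤ l * y := mul_le_mul_of_nonneg_left (hb hy) hl0
    simp only at hxy
    simp only [Set.mem_singleton_iff]
    linarith

/-- The one-dimensional Brunn–Minkowski inequality. -/
lemma volume_convexCombination_le {A B C : Set ℝ} (hA : MeasurableSet A)
    (hB : MeasurableSet B) (hAn : A.Nonempty) (hBn : B.Nonempty) {l : ℝ} (hl0 : 0 ≤ l)
    (hl1 : l ≤ 1) (hC : ∀ a ∈ A, ∀ b ∈ B, (1 - l) * a + l * b ∈ C) :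
    ENNReal.ofReal (1 - l) * volume A + ENNReal.ofReal l * volume B ≤ volume C := by
  obtain ⟨a, ha⟩ := hAn
  obtain ⟨b, hb⟩ := hBn
  have key : ∀ K ⊆ A, IsCompact K → ∀ L ⊆ B, IsCompact L →
      ENNReal.ofReal (1 - l) * volume K + ENNReal.ofReal l * volume L ≤ volume C := by
    intro K hKA hK L hLB hL
    -- Inner approximations may be empty; adjoining fixed points of A and B keeps them nonempty and
    -- compact.
    refine le_trans ?_ (volume_convexCombination_le_of_isCompact (hK.insert a) (hL.insert b)
      ⟨a, by simp⟩ ⟨b, by simp⟩ hl0 hl1 (C := C) ?_)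
    · gcongr <;> exact Set.subset_insert _ _
    · rintro x (rfl | hx) y (rfl | hy)
      · exact hC _ ha _ hb
      · exact hC _ ha _ (hLB hy)
      · exact hC _ (hKA hx) _ hb
      · exact hC _ (hKA hx) _ (hLB hy)
  rw [hA.measure_eq_iSup_isCompact, hB.measure_eq_iSup_isCompact]
  simp only [ENNReal.mul_iSup, iSup_and']
  exact ENNReal.biSup_add_biSup_le' ⟨∅, by simp⟩ ⟨∅, by simp⟩
    fun K hK L hL => key K hK.1 hK.2 L hL.1 hL.2

lemma ENNReal.rpow_mul_rpow_le_add {l : ℝ} (hl0 : 0 < l) (hl1 : l < 1) (x y : ℝ≥0∞) :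
    x ^ (1 - l) * y ^ l ≤ ENNReal.ofReal (1 - l) * x + ENNReal.ofReal l * y := by
  have h1 : 0 < 1 - l := by linarith
  rcases eq_or_ne x ⊤ with rfl | hx
  · rw [ENNReal.mul_top (by simpa using hl1)]; simp
  rcases eq_or_ne y ⊤ with rfl | hy
  · rw [ENNReal.mul_top (by simpa using hl0)]; simp
  lift x to NNReal using hx
  lift y to NNReal using hy
  have := NNReal.geom_mean_le_arith_mean2_weighted (1 - l).toNNReal l.toNNReal x y
    (by rw [← Real.toNNReal_add h1.le hl0.le]; simp)
  rw [Real.coe_toNNReal _ h1.le, Real.coe_toNNReal _ hl0.le] at this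
  rw [← ENNReal.coe_rpow_of_nonneg _ h1.le, ← ENNReal.coe_rpow_of_nonneg _ hl0.le]
  simp only [ENNReal.ofReal]
  exact_mod_cast this

/-- Layer-cake integration of one-dimensional Brunn–Minkowski for superlevel sets. Equal suprema are
essential: at every level t < 1 the superlevel sets of f and g are both nonempty. -/
lemma lintegral_convexCombination_le_of_iSup_eq_one {f g h : ℝ → ℝ≥0∞} (hf : Measurable f)
    (hg : Measurable g) (hh : Measurable h) (hf1 : ⨆ x, f x = 1) (hg1 : ⨆ x, g x = 1)
    {l : ℝ} (hl0 : 0 < l) (hl1 : l < 1)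
    (H : ∀ x y, f x ^ (1 - l) * g y ^ l ≤ h ((1 - l) * x + l * y)) :
    ENNReal.ofReal (1 - l) * (∫⁻ x, f x) + ENNReal.ofReal l * (∫⁻ x, g x) ≤ ∫⁻ x, h x := by
  have layer : ∀ u : ℝ → ℝ≥0∞, Measurable u → (∀ x, u x ≤ 1) →
      ∫⁻ x, u x = ∫⁻ t in Set.Ioi (0 : ℝ), volume {x | ENNReal.ofReal t < u x} := by
    intro u hu hu1
    have hfin : ∀ x, u x ≠ ⊤ := fun x => ne_top_of_le_ne_top ENNReal.one_ne_top (hu1 x)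
    have := lintegral_eq_lintegral_meas_lt (volume : Measure ℝ) (f := fun x => (u x).toReal)
      (Filter.Eventually.of_forall fun x => ENNReal.toReal_nonneg) hu.ennreal_toReal.aemeasurable
    simp only [ENNReal.ofReal_toReal (hfin _)] at this
    rw [this]
    refine setLIntegral_congr_fun measurableSet_Ioi fun t ht => ?_
    simp only [ENNReal.ofReal_lt_iff_lt_toReal (le_of_lt ht) (hfin _)]
  have hf' : ∀ x, f x ≤ 1 := fun x => hf1 ▸ le_iSup f x
  have hg' : ∀ x, g x ≤ 1 := fun x => hg1 ▸ le_iSup g x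
  have hm : ∀ u : ℝ → ℝ≥0∞, Measurable fun t : ℝ => volume {x | ENNReal.ofReal t < u x} := by
    intro u
    refine Antitone.measurable fun s t hst => measure_mono fun x hx => ?_
    exact lt_of_le_of_lt (ENNReal.ofReal_le_ofReal hst) hx
  calc _ = ∫⁻ t in Set.Ioi (0 : ℝ), (ENNReal.ofReal (1 - l) * volume {x | ENNReal.ofReal t < f x} +
        ENNReal.ofReal l * volume {x | ENNReal.ofReal t < g x}) := by
        rw [layer f hf hf', layer g hg hg', lintegral_add_left ((hm f).const_mul _),
          lintegral_const_mul _ (hm f), lintegral_const_mul _ (hm g)]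
    -- Capping h at 1 makes `layer` applicable to it; levels t ≥ 1 contribute nothing, since f and g
    -- do not exceed 1.
    _ ≤ ∫⁻ t in Set.Ioi (0 : ℝ), volume {x | ENNReal.ofReal t < min (h x) 1} := by
        refine setLIntegral_mono' measurableSet_Ioi fun t ht => ?_
        rcases lt_or_ge t 1 with ht1 | ht1
        · have ht1' : ENNReal.ofReal t < 1 := by simpa using ht1
          refine volume_convexCombination_le (measurableSet_lt measurable_const hf)
            (measurableSet_lt measurable_const hg) ?_ ?_ hl0.le hl1.le ?_
          · rw [← hf1] at ht1'; exact lt_iSup_iff.1 ht1'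
          · rw [← hg1] at ht1'; exact lt_iSup_iff.1 ht1'
          · intro a ha b hb
            refine lt_min (lt_of_lt_of_le ?_ (H a b)) ht1'
            have e : ENNReal.ofReal t =
                ENNReal.ofReal t ^ (1 - l) * ENNReal.ofReal t ^ l := by
              rw [← ENNReal.rpow_add _ _ (by simpa using ht) ENNReal.ofReal_ne_top]
              simp
            rw [e]
            exact ENNReal.mul_lt_mul (ENNReal.rpow_lt_rpow ha (by linarith))
              (ENNReal.rpow_lt_rpow hb hl0)
        · have ht1' : 1 ≤ ENNReal.ofReal t := by simpa using ht1
          have e1 : {x | ENNReal.ofReal t < f x} = ∅ := by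
            ext x; simpa using (hf' x).trans ht1'
          have e2 : {x | ENNReal.ofReal t < g x} = ∅ := by
            ext x; simpa using (hg' x).trans ht1'
          simp [e1, e2]
    _ = ∫⁻ x, min (h x) 1 := (layer _ (hh.min measurable_const) fun x => min_le_right _ _).symm
    _ ≤ ∫⁻ x, h x := lintegral_mono fun x => min_le_left _ _

/-- Dividing f, g, h by α, β and α^(1-l) β^l preserves the hypothesis and normalizes the suprema;
the arithmetic mean bound then dominates the geometric mean. -/
lemma prekopa_leindler_real_of_bounded {f g h : ℝ → ℝ≥0∞} (hf : Measurable f)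
    (hg : Measurable g) (hh : Measurable h) (hfb : ⨆ x, f x ≠ ⊤) (hgb : ⨆ x, g x ≠ ⊤)
    {l : ℝ} (hl0 : 0 < l) (hl1 : l < 1)
    (H : ∀ x y, f x ^ (1 - l) * g y ^ l ≤ h ((1 - l) * x + l * y)) :
    (∫⁻ x, f x) ^ (1 - l) * (∫⁻ x, g x) ^ l ≤ ∫⁻ x, h x := by
  have hl1' : 0 < 1 - l := by linarith
  set α := ⨆ x, f x with hα
  set β := ⨆ x, g x with hβ
  rcases eq_or_ne α 0 with h0 | hα0
  · have : ∀ x, f x = 0 := fun x => by simpa using (le_iSup f x).trans_eq (hα.symm.trans h0)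
    simp [this, hl1']
  rcases eq_or_ne β 0 with h0 | hβ0
  · have : ∀ x, g x = 0 := fun x => by simpa using (le_iSup g x).trans_eq (hβ.symm.trans h0)
    simp [this, hl0]
  set c := α ^ (1 - l) * β ^ l with hc
  have hc0 : c ≠ 0 := by
    simp [hc, ENNReal.rpow_eq_zero_iff, hα0, hβ0, hl0.not_gt, hl1'.not_gt, hfb, hgb]
  have hct : c ≠ ⊤ := ENNReal.mul_ne_top (ENNReal.rpow_ne_top_of_nonneg hl1'.le hfb)
    (ENNReal.rpow_ne_top_of_nonneg hl0.le hgb)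
  have key := lintegral_convexCombination_le_of_iSup_eq_one (f := fun x => α⁻¹ * f x)
    (g := fun x => β⁻¹ * g x) (h := fun x => c⁻¹ * h x) (hf.const_mul _) (hg.const_mul _)
    (hh.const_mul _) (by rw [← ENNReal.mul_iSup, ENNReal.inv_mul_cancel hα0 hfb])
    (by rw [← ENNReal.mul_iSup, ENNReal.inv_mul_cancel hβ0 hgb]) hl0 hl1 (by
      intro x y
      rw [ENNReal.mul_rpow_of_nonneg _ _ hl1'.le, ENNReal.mul_rpow_of_nonneg _ _ hl0.le,
        ENNReal.inv_rpow, ENNReal.inv_rpow]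
      calc _ = ((α ^ (1 - l))⁻¹ * (β ^ l)⁻¹) * (f x ^ (1 - l) * g y ^ l) := by ring
        _ ≤ _ := by
          rw [hc, ENNReal.mul_inv (Or.inr (ENNReal.rpow_ne_top_of_nonneg hl0.le hgb))
            (Or.inl (ENNReal.rpow_ne_top_of_nonneg hl1'.le hfb))]
          gcongr
          exact H x y)
  rw [lintegral_const_mul _ hf, lintegral_const_mul _ hg, lintegral_const_mul _ hh] at key
  have key2 := (ENNReal.rpow_mul_rpow_le_add hl0 hl1 _ _).trans key
  rw [ENNReal.mul_rpow_of_nonneg _ _ hl1'.le, ENNReal.mul_rpow_of_nonneg _ _ hl0.le,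
    ENNReal.inv_rpow, ENNReal.inv_rpow] at key2
  have key3 : c⁻¹ * ((∫⁻ x, f x) ^ (1 - l) * (∫⁻ x, g x) ^ l) ≤ c⁻¹ * ∫⁻ x, h x := by
    refine le_trans (le_of_eq ?_) key2
    rw [hc, ENNReal.mul_inv (Or.inr (ENNReal.rpow_ne_top_of_nonneg hl0.le hgb))
      (Or.inl (ENNReal.rpow_ne_top_of_nonneg hl1'.le hfb))]
    ring
  exact (ENNReal.mul_le_mul_iff_right (by simpa using hct) (by simpa using hc0)).1 key3

/-- The one-dimensional Prékopa–Leindler inequality. -/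
theorem prekopa_leindler_real {f g h : ℝ → ℝ≥0∞} (hf : Measurable f)
    (hg : Measurable g) (hh : Measurable h) {l : ℝ} (hl0 : 0 < l) (hl1 : l < 1)
    (H : ∀ x y, f x ^ (1 - l) * g y ^ l ≤ h ((1 - l) * x + l * y)) :
    (∫⁻ x, f x) ^ (1 - l) * (∫⁻ x, g x) ^ l ≤ ∫⁻ x, h x := by
  have hl1' : 0 < 1 - l := by linarith
  -- Truncation at height M reduces to bounded functions; monotone convergence commutes with the
  -- power.
  have trunc : ∀ u : ℝ → ℝ≥0∞, Measurable u → ∀ r : ℝ, 0 < r →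
      (∫⁻ x, u x) ^ r = ⨆ M : ℕ, (∫⁻ x, min (u x) M) ^ r := by
    intro u hu r hr
    have e : ∀ x, u x = ⨆ M : ℕ, min (u x) M := by
      intro x
      have := inf_iSup_eq (u x) (fun M : ℕ => (M : ℝ≥0∞))
      rw [ENNReal.iSup_natCast] at this
      simpa using this
    calc (∫⁻ x, u x) ^ r = (∫⁻ x, ⨆ M : ℕ, min (u x) M) ^ r := by simp_rw [← e]
      _ = (⨆ M : ℕ, ∫⁻ x, min (u x) M) ^ r := by
        rw [lintegral_iSup (fun M => hu.min measurable_const)]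
        intro M N hMN x
        exact min_le_min_left _ (by exact_mod_cast hMN)
      _ = _ := (ENNReal.orderIsoRpow r hr).map_iSup _
  rw [trunc f hf _ hl1', trunc g hg _ hl0, ENNReal.iSup_mul]
  refine iSup_le fun M => ?_
  rw [ENNReal.mul_iSup]
  refine iSup_le fun N => ?_
  refine prekopa_leindler_real_of_bounded (hf.min measurable_const) (hg.min measurable_const) hh
    ?_ ?_ hl0 hl1 fun x y => le_trans ?_ (H x y)
  · exact ne_top_of_le_ne_top (ENNReal.natCast_ne_top M) (iSup_le fun x => min_le_right _ _)
  · exact ne_top_of_le_ne_top (ENNReal.natCast_ne_top N) (iSup_le fun x => min_le_right _ _)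
  · gcongr <;> exact min_le_left _ _

/-- The Prékopa–Leindler inequality. -/
theorem prekopa_leindler (d : ℕ) {f g h : (Fin d → ℝ) → ℝ≥0∞} (hf : Measurable f)
    (hg : Measurable g) (hh : Measurable h) {l : ℝ} (hl0 : 0 < l) (hl1 : l < 1)
    (H : ∀ x y, f x ^ (1 - l) * g y ^ l ≤ h ((1 - l) • x + l • y)) :
    (∫⁻ x, f x) ^ (1 - l) * (∫⁻ x, g x) ^ l ≤ ∫⁻ x, h x := by
  induction d with
  | zero =>
    have e : ∀ u : (Fin 0 → ℝ) → ℝ≥0∞, ∫⁻ x, u x = u 0 := by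
      intro u
      have : ∀ x, u x = u 0 := fun x => congrArg u (Subsingleton.elim _ _)
      simp [this, volume_pi]
    rw [e, e, e]
    simpa using H 0 0
  | succ d ih =>
    have e : ∀ u : (Fin (d + 1) → ℝ) → ℝ≥0∞, Measurable u →
        ∫⁻ x, u x = ∫⁻ t : ℝ, ∫⁻ y : Fin d → ℝ, u (Fin.cons t y) := by
      intro u hu
      have mp := (volume_preserving_piFinSuccAbove (fun _ : Fin (d + 1) => ℝ) 0).symm
      rw [← mp.lintegral_comp hu, Measure.volume_eq_prod,
        lintegral_prod (fun a => u ((MeasurableEquiv.piFinSuccAbove (fun _ => ℝ) 0).symm a))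
        (hu.comp mp.measurable).aemeasurable]
      simp [MeasurableEquiv.piFinSuccAbove, Fin.insertNthEquiv]
    have hcons : Measurable fun z : ℝ × (Fin d → ℝ) => (Fin.cons z.1 z.2 : Fin (d + 1) → ℝ) := by
      refine measurable_pi_lambda _ fun i => ?_
      refine Fin.cases ?_ (fun j => ?_) i
      · simpa using measurable_fst
      · simp only [Fin.cons_succ]
        fun_prop
    have hm : ∀ u : (Fin (d + 1) → ℝ) → ℝ≥0∞, Measurable u →
        Measurable fun t : ℝ => ∫⁻ y : Fin d → ℝ, u (Fin.cons t y) := fun u hu =>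
      (hu.comp hcons).lintegral_prod_right'
    rw [e f hf, e g hg, e h hh]
    -- The fibre integrals satisfy the one-dimensional hypothesis by the induction hypothesis on the
    -- remaining coordinates.
    refine prekopa_leindler_real (hm f hf) (hm g hg) (hm h hh) hl0 hl1 fun s t => ?_
    refine ih ((hf.comp hcons).comp measurable_prodMk_left)
      ((hg.comp hcons).comp measurable_prodMk_left)
      ((hh.comp hcons).comp measurable_prodMk_left) fun x y => ?_
    convert H (Fin.cons s x) (Fin.cons t y) using 2
    ext i
    refine Fin.cases ?_ (fun j => ?_) i <;> simp

/-- The multiplicative form of the Brunn–Minkowski inequality. -/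
lemma volume_rpow_mul_rpow_le {d : ℕ} {A B C : Set (Fin d → ℝ)} (hA : MeasurableSet A)
    (hB : MeasurableSet B) (hC : MeasurableSet C) {l : ℝ} (hl0 : 0 < l) (hl1 : l < 1)
    (H : ∀ x ∈ A, ∀ y ∈ B, (1 - l) • x + l • y ∈ C) :
    volume A ^ (1 - l) * volume B ^ l ≤ volume C := by
  have hl1' : 0 < 1 - l := by linarith
  have := prekopa_leindler d (f := A.indicator 1) (g := B.indicator 1) (h := C.indicator 1)
    (measurable_one.indicator hA) (measurable_one.indicator hB) (measurable_one.indicator hC)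
    hl0 hl1 (by
      intro x y
      by_cases hx : x ∈ A
      · by_cases hy : y ∈ B
        · simp [hx, hy, H x hx y hy]
        · simp [hy, hl0]
      · simp [hx, hl1'])
  simpa [lintegral_indicator_one, hA, hB, hC] using this

/-- The Brunn–Minkowski inequality, for sets of positive finite volume. -/
theorem brunn_minkowski {d : ℕ} {A B C : Set (Fin d → ℝ)} (hA : MeasurableSet A)
    (hB : MeasurableSet B) (hC : MeasurableSet C) {l a b : ℝ} (hl0 : 0 < l) (hl1 : l < 1)
    (ha : 0 < a) (hb : 0 < b) (hAa : volume A = ENNReal.ofReal (a ^ d))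
    (hBb : volume B = ENNReal.ofReal (b ^ d))
    (H : ∀ x ∈ A, ∀ y ∈ B, (1 - l) • x + l • y ∈ C) :
    ENNReal.ofReal (((1 - l) * a + l * b) ^ d) ≤ volume C := by
  have hl1' : 0 < 1 - l := by linarith
  set c := (1 - l) * a + l * b with hc
  have hc0 : 0 < c := by positivity
  have unit : ∀ (S : Set (Fin d → ℝ)) (r : ℝ), 0 < r → volume S = ENNReal.ofReal (r ^ d) →
      volume (r⁻¹ • S) = 1 := by
    intro S r hr hS
    rw [Measure.addHaar_smul, hS, ← ENNReal.ofReal_mul (abs_nonneg _), abs_of_pos (by positivity)]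
    simp [hr.ne']
  -- A and B are rescaled to unit volume. With weight λ = lb/c one has (1-λ)a⁻¹x + λb⁻¹y =
  -- c⁻¹((1-l)x + ly), so the multiplicative form gives vol(c⁻¹C) ≥ 1.
  have := volume_rpow_mul_rpow_le (hA.const_smul₀ a⁻¹) (hB.const_smul₀ b⁻¹) (hC.const_smul₀ c⁻¹)
    (l := l * b / c) (by positivity) (by rw [div_lt_one hc0, hc]; nlinarith) (by
      rintro _ ⟨x, hx, rfl⟩ _ ⟨y, hy, rfl⟩
      refine ⟨_, H x hx y hy, ?_⟩
      ext i
      simp only [Pi.smul_apply, Pi.add_apply, smul_eq_mul]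
      field_simp
      rw [hc]; ring)
  rw [unit A a ha hAa, unit B b hb hBb, Measure.addHaar_smul] at this
  simp only [ENNReal.one_rpow, one_mul, Module.finrank_fintype_fun_eq_card,
    Fintype.card_fin] at this
  rw [abs_of_pos (by positivity)] at this
  calc ENNReal.ofReal (c ^ d) ≤ ENNReal.ofReal (c ^ d) * (ENNReal.ofReal (c⁻¹ ^ d) * volume C) := by
        conv_lhs => rw [← mul_one (ENNReal.ofReal _)]
        gcongr
    _ = volume C := by
        rw [← mul_assoc, ← ENNReal.ofReal_mul (by positivity)]
        simp [hc0.ne']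

end BrunnMinkowski

/-! ### Tail integrals and the stop-loss transform -/

section StopLoss

/-- The tail integral `∫_{t > z} D t`. -/
noncomputable def tailIntegral (D : ℝ → ℝ) (z : ℝ) : ℝ := ∫ t in Set.Ioi z, D t

/-- The stop-loss transform `∫ (t - x)₊ D t`. -/
noncomputable def stopLoss (D : ℝ → ℝ) (x : ℝ) : ℝ := ∫ t, max (t - x) 0 * D t

/-- An integrable function supported in `[-R, R]` with vanishing integral and first moment. -/
structure IsBalanced (D : ℝ → ℝ) (R : ℝ) : Prop where
  integrable : Integrable D
  eq_zero : ∀ t, R < |t| → D t = 0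
  integral_eq : ∫ t, D t = 0
  mean_eq : ∫ t, t * D t = 0

lemma integrable_continuous_mul_of_support {D : ℝ → ℝ} {R : ℝ} (hD : Integrable D)
    (hR : ∀ t, R < |t| → D t = 0) {h : ℝ → ℝ} (hh : Continuous h) :
    Integrable fun t => h t * D t := by
  have h1 : IntegrableOn (fun t => h t * D t) (Set.Icc (-R) R) :=
    hD.integrableOn.continuousOn_mul hh.continuousOn isCompact_Icc
  refine (integrableOn_iff_integrable_of_support_subset ?_).1 h1
  intro t ht
  by_contra hn
  refine ht ?_
  simp only
  rw [hR t, mul_zero]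
  by_contra! h'
  exact hn (abs_le.1 h')

lemma integral_mul_integral_kernel {w D : ℝ → ℝ} (hw : Integrable w) (hD : Integrable D)
    {k : ℝ → ℝ → ℝ} (hk : Measurable (Function.uncurry k)) (C : ℝ) (hkC : ∀ x t, |k x t| ≤ C) :
    ∫ x, w x * ∫ t, k x t * D t = ∫ t, (∫ x, w x * k x t) * D t := by
  have h1 : Integrable (fun z : ℝ × ℝ => k z.1 z.2 * (w z.1 * D z.2))
      (volume.prod volume) := by
    refine (hw.mul_prod hD).bdd_mul (c := C) hk.aestronglyMeasurable ?_
    exact Filter.Eventually.of_forall fun z => hkC z.1 z.2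
  calc _ = ∫ x, ∫ t, k x t * (w x * D t) := by
        congr 1; ext x; rw [← integral_const_mul]; congr 1; ext t; ring
    _ = ∫ t, ∫ x, k x t * (w x * D t) := integral_integral_swap h1
    _ = _ := by
        congr 1; ext t; rw [← integral_mul_const]; congr 1; ext x; ring

lemma tailIntegral_sub {D : ℝ → ℝ} (hD : Integrable D) (x y : ℝ) :
    tailIntegral D x - tailIntegral D y = ∫ t in x..y, D t :=
  intervalIntegral.integral_Ioi_sub_Ioi' hD.integrableOn hD.integrableOn

lemma continuous_tailIntegral {D : ℝ → ℝ} (hD : Integrable D) : Continuous (tailIntegral D) := by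
  have : tailIntegral D = fun z => tailIntegral D 0 - ∫ t in (0 : ℝ)..z, D t := by
    ext z; rw [← tailIntegral_sub hD]; ring
  rw [this]
  exact continuous_const.sub (intervalIntegral.continuous_primitive
    (fun a b => hD.intervalIntegrable) 0)

/-- Fubini applied to (t-x)₊ - (t-y)₊ = ∫_x^y 1_{z<t} dz: the transform is a primitive of minus the
tail integral. -/
lemma stopLoss_sub_of_le {D : ℝ → ℝ} {R : ℝ} (hD : Integrable D)
    (hR : ∀ t, R < |t| → D t = 0) {x y : ℝ} (hxy : x ≤ y) :
    stopLoss D x - stopLoss D y = ∫ z in x..y, tailIntegral D z := by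
  have hw : Integrable ((Set.Ioc x y).indicator (fun _ => (1 : ℝ))) := by
    rw [integrable_indicator_iff measurableSet_Ioc]; simp
  have hk : Measurable (Function.uncurry fun z t : ℝ => if z < t then (1 : ℝ) else 0) :=
    Measurable.ite (measurableSet_lt measurable_fst measurable_snd) measurable_const
      measurable_const
  have key := integral_mul_integral_kernel hw hD hk 1 (by intro z t; split_ifs <;> simp)
  rw [stopLoss, stopLoss, ← integral_sub
    (integrable_continuous_mul_of_support hD hR (by fun_prop))
    (integrable_continuous_mul_of_support hD hR (by fun_prop)),
    intervalIntegral.integral_of_le hxy, ← integral_indicator measurableSet_Ioc]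
  calc _ = ∫ t, (∫ z, (Set.Ioc x y).indicator (fun _ => (1 : ℝ)) z * if z < t then (1 : ℝ) else 0)
        * D t := by
        congr 1; ext t
        rw [← sub_mul]; congr 1
        have : (fun z => (Set.Ioc x y).indicator (fun _ => (1 : ℝ)) z *
            if z < t then (1 : ℝ) else 0)
            = (Set.Ioc x y ∩ Set.Iio t).indicator (fun _ => (1 : ℝ)) := by
          ext z
          by_cases h1 : z ∈ Set.Ioc x y <;> by_cases h2 : z < t <;> simp [h1, h2]
        rw [this, integral_indicator (measurableSet_Ioc.inter measurableSet_Iio)]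
        simp only [integral_const, MeasurableSet.univ, measureReal_restrict_apply, Set.univ_inter,
          smul_eq_mul, mul_one]
        rcases le_total t y with h | h
        · have : Set.Ioc x y ∩ Set.Iio t = Set.Ioo x t := by
            ext z; simp only [Set.mem_inter_iff, Set.mem_Ioc, Set.mem_Iio, Set.mem_Ioo]
            constructor
            · rintro ⟨⟨a, b⟩, c⟩; exact ⟨a, c⟩
            · rintro ⟨a, c⟩; exact ⟨⟨a, by linarith⟩, c⟩
          rw [this, Real.volume_real_Ioo, max_eq_right (b := (0 : ℝ)) (a := t - y) (by linarith),
            sub_zero]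
        · rw [max_eq_left (by linarith), max_eq_left (by linarith)]
          have : volume.real (Set.Ioc x y ∩ Set.Iio t) = volume.real (Set.Ioc x y) := by
            refine measureReal_congr ?_
            have : (Set.Iio y : Set ℝ) =ᵐ[volume] Set.Iic y := Iio_ae_eq_Iic
            filter_upwards [this] with z hz
            have hz' : (z < y) = (z ≤ y) := hz
            refine propext ⟨fun h => h.1, fun h' => ⟨h', ?_⟩⟩
            have : z ≤ y := h'.2
            rw [← hz'] at this
            exact lt_of_lt_of_le this h
          rw [this, Real.volume_real_Ioc_of_le hxy]
          ring
    _ = _ := key.symm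
    _ = _ := by
        congr 1; ext z
        by_cases hz : z ∈ Set.Ioc x y
        · simp only [hz, Set.indicator_of_mem, one_mul]
          rw [tailIntegral, ← integral_indicator measurableSet_Ioi]
          congr 1; ext t
          by_cases h : z < t <;> simp [h]
        · simp [hz]

lemma stopLoss_sub {D : ℝ → ℝ} {R : ℝ} (hD : Integrable D)
    (hR : ∀ t, R < |t| → D t = 0) (x y : ℝ) :
    stopLoss D x - stopLoss D y = ∫ z in x..y, tailIntegral D z := by
  rcases le_total x y with h | h
  · exact stopLoss_sub_of_le hD hR h
  · rw [intervalIntegral.integral_symm, ← stopLoss_sub_of_le hD hR h]; ring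

lemma continuous_stopLoss {D : ℝ → ℝ} {R : ℝ} (hD : Integrable D)
    (hR : ∀ t, R < |t| → D t = 0) : Continuous (stopLoss D) := by
  have : stopLoss D = fun z => stopLoss D 0 - ∫ t in (0 : ℝ)..z, tailIntegral D t := by
    ext z; rw [← stopLoss_sub hD hR]; ring
  rw [this]
  exact continuous_const.sub (intervalIntegral.continuous_primitive
    (fun a b => (continuous_tailIntegral hD).intervalIntegrable _ _) 0)

lemma exists_pos_of_intervalIntegral_pos {F : ℝ → ℝ} {x y : ℝ} (hxy : x < y)
    (h : 0 < ∫ t in x..y, F t) : ∃ z ∈ Set.Ioo x y, 0 < F z := by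
  by_contra! hn
  refine absurd h (not_lt.2 ?_)
  rw [intervalIntegral.integral_of_le hxy.le, ← integral_Ioc_eq_integral_Ioo.symm]
  exact setIntegral_nonpos measurableSet_Ioo hn

lemma exists_neg_of_intervalIntegral_neg {F : ℝ → ℝ} {x y : ℝ} (hxy : x < y)
    (h : ∫ t in x..y, F t < 0) : ∃ z ∈ Set.Ioo x y, F z < 0 := by
  obtain ⟨z, hz, h1⟩ := exists_pos_of_intervalIntegral_pos (F := fun t => -F t) hxy
    (by simpa using h)
  exact ⟨z, hz, by linarith⟩

namespace IsBalanced

variable {D : ℝ → ℝ} {R : ℝ}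

/-- This and the next three lemmas are the discrete mean value steps behind the count of sign
changes: a strict change of the transform gives a sign of the tail, and a strict change of the tail
gives a sign of D. -/
lemma tail_pos (hD : IsBalanced D R) {x y : ℝ} (hxy : x < y) (h : stopLoss D y < stopLoss D x) :
    ∃ z ∈ Set.Ioo x y, 0 < tailIntegral D z :=
  exists_pos_of_intervalIntegral_pos hxy
    (by rw [← stopLoss_sub hD.integrable hD.eq_zero]; linarith)

lemma tail_neg (hD : IsBalanced D R) {x y : ℝ} (hxy : x < y) (h : stopLoss D x < stopLoss D y) :
    ∃ z ∈ Set.Ioo x y, tailIntegral D z < 0 :=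
  exists_neg_of_intervalIntegral_neg hxy
    (by rw [← stopLoss_sub hD.integrable hD.eq_zero]; linarith)

lemma pos_of_tail (hD : IsBalanced D R) {x y : ℝ} (hxy : x < y)
    (h : tailIntegral D y < tailIntegral D x) : ∃ z ∈ Set.Ioo x y, 0 < D z :=
  exists_pos_of_intervalIntegral_pos hxy (by rw [← tailIntegral_sub hD.integrable]; linarith)

lemma neg_of_tail (hD : IsBalanced D R) {x y : ℝ} (hxy : x < y)
    (h : tailIntegral D x < tailIntegral D y) : ∃ z ∈ Set.Ioo x y, D z < 0 :=
  exists_neg_of_intervalIntegral_neg hxy (by rw [← tailIntegral_sub hD.integrable]; linarith)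

lemma tailIntegral_of_ge (hD : IsBalanced D R) {z : ℝ} (hz : R ≤ z) : tailIntegral D z = 0 := by
  refine setIntegral_eq_zero_of_forall_eq_zero fun t ht => hD.eq_zero t ?_
  exact lt_of_le_of_lt hz (lt_of_lt_of_le ht (le_abs_self t))

lemma tailIntegral_of_le (hD : IsBalanced D R) {z : ℝ} (hz : z < -R) : tailIntegral D z = 0 := by
  rw [← hD.integral_eq]
  refine setIntegral_eq_integral_of_forall_compl_eq_zero fun t ht => hD.eq_zero t ?_
  have : t ≤ z := not_lt.1 ht
  exact lt_of_lt_of_le (by linarith) (neg_le_abs t)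

lemma stopLoss_of_ge (hD : IsBalanced D R) {z : ℝ} (hz : R ≤ z) : stopLoss D z = 0 := by
  refine integral_eq_zero_of_ae (Filter.Eventually.of_forall fun t => ?_)
  simp only [Pi.zero_apply, mul_eq_zero]
  rcases le_or_gt t z with h | h
  · left; exact max_eq_right (by linarith)
  · right; exact hD.eq_zero t (lt_of_le_of_lt hz (lt_of_lt_of_le h (le_abs_self t)))

lemma integral_affine (hD : IsBalanced D R) (x : ℝ) : ∫ t, (t - x) * D t = 0 := by
  have h1 : Integrable fun t => t * D t :=
    integrable_continuous_mul_of_support hD.integrable hD.eq_zero continuous_id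
  simp only [sub_mul]
  rw [integral_sub h1 (hD.integrable.const_mul x), integral_const_mul, hD.integral_eq, hD.mean_eq]
  simp

/-- On the support the positive part is t - z, and affine functions integrate to zero against D. -/
lemma stopLoss_of_le (hD : IsBalanced D R) {z : ℝ} (hz : z ≤ -R) : stopLoss D z = 0 := by
  rw [← hD.integral_affine z, stopLoss]
  congr 1; ext t
  rcases lt_or_ge t z with h | h
  · rw [hD.eq_zero t (lt_of_lt_of_le (by linarith) (neg_le_abs t))]; simp
  · rw [max_eq_left (by linarith)]

lemma comp_neg (hD : IsBalanced D R) : IsBalanced (fun t => D (-t)) R where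
  integrable := hD.integrable.comp_neg
  eq_zero t ht := hD.eq_zero _ (by simpa using ht)
  integral_eq := by rw [integral_neg_eq_self, hD.integral_eq]
  mean_eq := by
    rw [← integral_neg_eq_self]
    simp only [neg_neg, neg_mul, integral_neg, hD.mean_eq, neg_zero]

/-- Since s₊ - (-s)₊ = s and affine functions integrate to zero against D, the left and right
transforms coincide. Every result on the positive half-line thereby has a mirror image. -/
lemma stopLoss_comp_neg (hD : IsBalanced D R) (x : ℝ) :
    stopLoss (fun t => D (-t)) x = stopLoss D (-x) := by
  have h1 : Integrable fun t => max (t - -x) 0 * D t :=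
    integrable_continuous_mul_of_support hD.integrable hD.eq_zero (by fun_prop)
  have h2 : Integrable fun t => (t - -x) * D t :=
    integrable_continuous_mul_of_support hD.integrable hD.eq_zero (by fun_prop)
  have h3 : stopLoss D (-x) = ∫ t, (max (t - -x) 0 * D t - (t - -x) * D t) := by
    rw [integral_sub h1 h2, hD.integral_affine, sub_zero, stopLoss]
  rw [h3, stopLoss, ← integral_neg_eq_self]
  congr 1; ext t
  simp only [neg_neg]
  rw [← sub_mul]
  congr 1
  rcases le_total 0 (t + x) with h | h
  · rw [max_eq_right (by linarith), max_eq_left (by linarith)]; ring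
  · rw [max_eq_left (by linarith), max_eq_right (by linarith)]; ring

end IsBalanced

end StopLoss

/-! ### Moments of the stop-loss transform and sign changes -/

section SignChanges

/-- The positive-part moment `∫ t₊ ^ p D t`. -/
noncomputable def posMoment (p : ℝ) (D : ℝ → ℝ) : ℝ := ∫ t, max t 0 ^ p * D t

/-- Taylor's formula with integral remainder: t₊^p is a mixture of the functions (t - x)₊, which
expresses moments through the stop-loss transform. -/
lemma integral_rpow_mul_posPart {p R t : ℝ} (hp : 1 < p) (ht : t ≤ R) :
    ∫ x in Set.Ioc 0 R, x ^ (p - 2) * max (t - x) 0 = max t 0 ^ p / (p * (p - 1)) := by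
  rcases le_or_gt t 0 with h | h
  · rw [max_eq_right h, Real.zero_rpow (by linarith), zero_div]
    refine setIntegral_eq_zero_of_forall_eq_zero fun x hx => ?_
    rw [max_eq_right (by linarith [hx.1]), mul_zero]
  · have h1 : ∫ x in Set.Ioc 0 R, x ^ (p - 2) * max (t - x) 0 =
        ∫ x in (0 : ℝ)..t, (t * x ^ (p - 2) - x ^ (p - 1)) := by
      rw [setIntegral_eq_of_subset_of_forall_sdiff_eq_zero measurableSet_Ioc
        (Set.Ioc_subset_Ioc_right ht), intervalIntegral.integral_of_le h.le]
      · refine setIntegral_congr_fun measurableSet_Ioc fun x hx => ?_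
        have : x ^ (p - 1) = x ^ (p - 2) * x := by
          rw [← Real.rpow_add_one hx.1.ne']; ring_nf
        rw [max_eq_left (by linarith [hx.2]), this]; ring
      · rintro x ⟨hx, hx'⟩
        have : t < x := by
          by_contra! h'
          exact hx' ⟨hx.1, h'⟩
        rw [max_eq_right (by linarith), mul_zero]
    rw [h1, intervalIntegral.integral_sub
      ((intervalIntegral.intervalIntegrable_rpow' (by linarith)).const_mul t)
      (intervalIntegral.intervalIntegrable_rpow' (by linarith)),
      intervalIntegral.integral_const_mul,
      integral_rpow (Or.inl (by linarith)), integral_rpow (Or.inl (by linarith)),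
      Real.zero_rpow (by linarith), Real.zero_rpow (by linarith), max_eq_left h.le]
    have e1 : p - 2 + 1 = p - 1 := by ring
    have e2 : p - 1 + 1 = p := by ring
    have e3 : t ^ p = t ^ (p - 1) * t := by rw [← Real.rpow_add_one h.ne']; ring_nf
    rw [e1, e2, e3]
    have : p - 1 ≠ 0 := by linarith
    have : p ≠ 0 := by linarith
    field_simp
    ring

lemma integrableOn_rpow_mul {p R : ℝ} (hp : 1 < p) {G : ℝ → ℝ} (hG : Continuous G) :
    IntegrableOn (fun x => x ^ (p - 2) * G x) (Set.Ioc 0 R) := by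
  rcases le_or_gt R 0 with h | h
  · simp [Set.Ioc_eq_empty (not_lt.2 h)]
  have := (intervalIntegral.intervalIntegrable_rpow' (a := 0) (b := R)
    (show -1 < p - 2 by linarith)).mul_continuousOn hG.continuousOn
  rwa [intervalIntegrable_iff_integrableOn_Ioc_of_le h.le] at this

lemma integral_rpow_mul_stopLoss {D : ℝ → ℝ} {R p : ℝ} (hp : 1 < p)
    (hD : Integrable D) (hR : ∀ t, R < |t| → D t = 0) :
    ∫ x in Set.Ioc 0 R, x ^ (p - 2) * stopLoss D x = posMoment p D / (p * (p - 1)) := by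
  have hw : Integrable ((Set.Ioc 0 R).indicator fun x : ℝ => x ^ (p - 2)) := by
    rw [integrable_indicator_iff measurableSet_Ioc]
    simpa using integrableOn_rpow_mul (R := R) hp (G := fun _ => 1) continuous_const
  -- Clipping at |R| makes the kernel bounded; for x > 0 and t in the support of D the clip is
  -- inactive.
  have key := integral_mul_integral_kernel hw hD
    (k := fun x t => min (max (t - x) 0) |R|) (by unfold Function.uncurry; fun_prop) |R| (by
      intro x t
      rw [abs_of_nonneg (le_min (le_max_right _ _) (abs_nonneg _))]
      exact min_le_right _ _)
  have hclip : ∀ x t, 0 < x → D t ≠ 0 → min (max (t - x) 0) |R| = max (t - x) 0 := by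
    intro x t hx ht
    have : |t| ≤ R := by
      by_contra! h
      exact ht (hR t h)
    refine min_eq_left (max_le ?_ (abs_nonneg _))
    linarith [le_abs_self t, le_abs_self R]
  rw [posMoment, ← integral_div, ← integral_indicator measurableSet_Ioc]
  calc _ = _ := ?_
    _ = _ := key
    _ = _ := ?_
  · congr 1; ext x
    by_cases hx : x ∈ Set.Ioc 0 R
    · simp only [hx, Set.indicator_of_mem, stopLoss]
      congr 2; ext t
      by_cases ht : D t = 0
      · simp [ht]
      · rw [hclip x t hx.1 ht]
    · simp [hx]
  · congr 1; ext t
    by_cases ht : D t = 0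
    · simp [ht]
    have htR : t ≤ R := by
      by_contra! h
      exact ht (hR t (h.trans_le (le_abs_self t)))
    rw [mul_div_right_comm, ← integral_rpow_mul_posPart hp htR,
      ← integral_indicator measurableSet_Ioc]
    congr 2; ext x
    by_cases hx : x ∈ Set.Ioc 0 R
    · simp only [hx, Set.indicator_of_mem]
      rw [hclip x t hx.1 ht]
    · simp [hx]

lemma eq_zero_of_integral_rpow_mul_eq_zero {G : ℝ → ℝ} (hG : Continuous G) {R p : ℝ} (hp : 1 < p)
    (h0 : ∀ x ∈ Set.Ioc 0 R, 0 ≤ G x) (h : ∫ x in Set.Ioc 0 R, x ^ (p - 2) * G x = 0) :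
    ∀ x ∈ Set.Ioc 0 R, G x = 0 := by
  have h1 := (setIntegral_eq_zero_iff_of_nonneg_ae
    ((ae_restrict_iff' measurableSet_Ioc).2 (Filter.Eventually.of_forall fun x hx =>
      mul_nonneg (Real.rpow_nonneg hx.1.le _) (h0 x hx))) (integrableOn_rpow_mul hp hG)).1 h
  refine Measure.eqOn_Ioc_of_ae_eq (μ := volume) (g := fun _ => 0) ?_ hG.continuousOn
    continuousOn_const
  filter_upwards [h1, ae_restrict_mem measurableSet_Ioc] with x hx hx'
  have : x ^ (p - 2) ≠ 0 := (Real.rpow_pos_of_pos hx'.1 _).ne'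
  simpa [this] using hx

/-- If G passes from - to + at y, then (x^(q-p) - y^(q-p)) G(x) ≥ 0. Subtracting y^(q-p) times the
vanishing p-integral from the q-integral leaves a nonnegative integrand, zero only where G = 0 or x
= y. -/
lemma single_crossing {G : ℝ → ℝ} (hG : Continuous G) {R p q : ℝ} (hp : 1 < p) (hpq : p < q)
    (hno : ∀ x y, 0 < x → x < y → 0 < G x → ¬ G y < 0)
    (h : ∫ x in Set.Ioc 0 R, x ^ (p - 2) * G x = 0) :
    0 ≤ ∫ x in Set.Ioc 0 R, x ^ (q - 2) * G x ∧
      (∫ x in Set.Ioc 0 R, x ^ (q - 2) * G x = 0 → ∀ x ∈ Set.Ioc 0 R, G x = 0) := by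
  -- The crossing point is the supremum of the set where G < 0, or 0 if that set is empty.
  obtain ⟨y, hy0, hy⟩ : ∃ y : ℝ, 0 ≤ y ∧ ∀ x ∈ Set.Ioc 0 R, (x < y → G x ≤ 0) ∧
      (y < x → 0 ≤ G x) := by
    by_cases hne : ∃ x ∈ Set.Ioc 0 R, G x < 0
    · set S := {x | x ∈ Set.Ioc 0 R ∧ G x < 0} with hS
      have hbdd : BddAbove S := ⟨R, fun x hx => hx.1.2⟩
      obtain ⟨x0, hx0, hx0'⟩ := hne
      refine ⟨sSup S, hx0.1.le.trans (le_csSup hbdd ⟨hx0, hx0'⟩), fun x hx => ⟨fun hlt => ?_,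
        fun hlt => ?_⟩⟩
      · obtain ⟨z, hz, hxz⟩ := exists_lt_of_lt_csSup (s := S) ⟨x0, hx0, hx0'⟩ hlt
        by_contra! hpos
        exact hno x z hx.1 hxz hpos hz.2
      · by_contra! hneg
        exact absurd (le_csSup hbdd (show x ∈ S from ⟨hx, hneg⟩)) (not_le.2 hlt)
    · push Not at hne
      exact ⟨0, le_rfl, fun x hx => ⟨fun hlt => absurd hx.1 (not_lt.2 hlt.le), fun _ => hne x hx⟩⟩
  have hq : 1 < q := hp.trans hpq
  have hr : 0 < q - p := by linarith
  have e : ∫ x in Set.Ioc 0 R, x ^ (q - 2) * G x =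
      ∫ x in Set.Ioc 0 R, (x ^ (q - 2) * G x - y ^ (q - p) * (x ^ (p - 2) * G x)) := by
    rw [integral_sub (integrableOn_rpow_mul hq hG) ((integrableOn_rpow_mul hp hG).const_mul _),
      integral_const_mul, h]
    simp
  have e2 : ∀ x ∈ Set.Ioc 0 R, x ^ (q - 2) * G x - y ^ (q - p) * (x ^ (p - 2) * G x) =
      x ^ (p - 2) * ((x ^ (q - p) - y ^ (q - p)) * G x) := by
    intro x hx
    have : x ^ (q - 2) = x ^ (p - 2) * x ^ (q - p) := by
      rw [← Real.rpow_add hx.1]; ring_nf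
    rw [this]; ring
  have hnn : ∀ x ∈ Set.Ioc 0 R,
      0 ≤ x ^ (q - 2) * G x - y ^ (q - p) * (x ^ (p - 2) * G x) := by
    intro x hx
    rw [e2 x hx]
    refine mul_nonneg (Real.rpow_nonneg hx.1.le _) ?_
    rcases lt_trichotomy x y with hlt | rfl | hlt
    · exact mul_nonneg_of_nonpos_of_nonpos
        (sub_nonpos.2 (Real.rpow_le_rpow hx.1.le hlt.le hr.le)) ((hy x hx).1 hlt)
    · simp
    · exact mul_nonneg (sub_nonneg.2 (Real.rpow_le_rpow hy0 hlt.le hr.le)) ((hy x hx).2 hlt)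
  rw [e]
  refine ⟨setIntegral_nonneg measurableSet_Ioc hnn, fun hz => ?_⟩
  have h1 := (setIntegral_eq_zero_iff_of_nonneg_ae
    ((ae_restrict_iff' measurableSet_Ioc).2 (Filter.Eventually.of_forall hnn))
    ((integrableOn_rpow_mul hq hG).sub ((integrableOn_rpow_mul hp hG).const_mul _))).1 hz
  refine Measure.eqOn_Ioc_of_ae_eq (μ := volume) (g := fun _ => 0) ?_ hG.continuousOn
    continuousOn_const
  have hne : ∀ᵐ x ∂(volume.restrict (Set.Ioc 0 R)), x ≠ y :=
    ae_restrict_of_ae (by simp [ae_iff])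
  filter_upwards [h1, ae_restrict_mem measurableSet_Ioc, hne] with x hx hx' hxy
  rw [e2 x hx', Pi.zero_apply] at hx
  have h2 : x ^ (p - 2) ≠ 0 := (Real.rpow_pos_of_pos hx'.1 _).ne'
  have h3 : x ^ (q - p) - y ^ (q - p) ≠ 0 := by
    rw [sub_ne_zero]
    intro h
    exact hxy ((Real.rpow_left_inj hx'.1.le hy0 hr.ne').1 h)
  simpa [h2, h3] using hx

namespace IsBalanced

variable {D : ℝ → ℝ} {R : ℝ}

/-- If `D` has no sign alternation `-,+,-,+,-`, then its stop-loss transform has no sign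
alternation `-,+,-`. -/
lemma stopLoss_alternation (hD : IsBalanced D R)
    (alt : ∀ x₁ x₂ x₃ x₄ x₅, x₁ < x₂ → x₂ < x₃ → x₃ < x₄ → x₄ < x₅ →
      D x₁ < 0 → 0 < D x₂ → D x₃ < 0 → 0 < D x₄ → ¬ D x₅ < 0)
    {x y z : ℝ} (hxy : x < y) (hyz : y < z) (hx : stopLoss D x < 0) (hy : 0 < stopLoss D y) :
    ¬ stopLoss D z < 0 := by
  intro hz
  obtain ⟨a, ha⟩ := exists_lt (min x (-R))
  obtain ⟨b, hb⟩ := exists_gt (max z R)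
  have hax := ha.trans_le (min_le_left _ _)
  have haR := ha.trans_le (min_le_right _ _)
  have hzb := (le_max_left _ _).trans_lt hb
  have hRb := (le_max_right _ _).trans_lt hb
  have h0 := hD.stopLoss_of_le haR.le
  have h0' := hD.stopLoss_of_ge hRb.le
  -- The transform vanishes at both far ends, so -,+,- forces +,-,+,- in the tail; the tail also
  -- vanishes at the ends, so this forces -,+,-,+,- in D.
  obtain ⟨z₁, m₁, t₁⟩ := hD.tail_pos hax (by linarith)
  obtain ⟨z₂, m₂, t₂⟩ := hD.tail_neg hxy (by linarith)
  obtain ⟨z₃, m₃, t₃⟩ := hD.tail_pos hyz (by linarith)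
  obtain ⟨z₄, m₄, t₄⟩ := hD.tail_neg hzb (by linarith)
  have k0 := hD.tailIntegral_of_le haR
  have k0' := hD.tailIntegral_of_ge hRb.le
  obtain ⟨s₁, n₁, u₁⟩ := hD.neg_of_tail m₁.1 (by linarith)
  obtain ⟨s₂, n₂, u₂⟩ := hD.pos_of_tail (m₁.2.trans m₂.1) (by linarith)
  obtain ⟨s₃, n₃, u₃⟩ := hD.neg_of_tail (m₂.2.trans m₃.1) (by linarith)
  obtain ⟨s₄, n₄, u₄⟩ := hD.pos_of_tail (m₃.2.trans m₄.1) (by linarith)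
  obtain ⟨s₅, n₅, u₅⟩ := hD.neg_of_tail m₄.2 (by linarith)
  exact alt s₁ s₂ s₃ s₄ s₅ (n₁.2.trans n₂.1) (n₂.2.trans n₃.1) (n₃.2.trans n₄.1)
    (n₄.2.trans n₅.1) u₁ u₂ u₃ u₄ u₅

lemma integral_rpow_mul_stopLoss_neg {p : ℝ} (hp : 1 < p) (hD : IsBalanced D R) :
    ∫ x in Set.Ioc 0 R, x ^ (p - 2) * stopLoss D (-x) =
      posMoment p (fun t => D (-t)) / (p * (p - 1)) := by
  rw [← integral_rpow_mul_stopLoss hp hD.comp_neg.integrable hD.comp_neg.eq_zero]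
  simp only [hD.stopLoss_comp_neg]

lemma hasDerivAt_stopLoss (hD : IsBalanced D R) (x : ℝ) :
    HasDerivAt (stopLoss D) (-tailIntegral D x) x := by
  have hc := continuous_tailIntegral hD.integrable
  have e : stopLoss D = fun z => stopLoss D x - ∫ t in x..z, tailIntegral D t := by
    ext z; rw [← stopLoss_sub hD.integrable hD.eq_zero]; ring
  rw [e]
  exact (intervalIntegral.integral_hasDerivAt_right (hc.intervalIntegrable _ _)
    (hc.stronglyMeasurableAtFilter _ _) hc.continuousAt).const_sub _

/-- The tail at 0 is minus the derivative of the transform, which can be computed from the left. -/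
lemma tailIntegral_zero_of_nonpos (hD : IsBalanced D R) (h : ∀ x ≤ 0, stopLoss D x = 0) :
    tailIntegral D 0 = 0 := by
  have h1 := (hD.hasDerivAt_stopLoss 0).hasDerivWithinAt (s := Set.Iic 0)
  have h2 : HasDerivWithinAt (stopLoss D) 0 (Set.Iic 0) 0 :=
    (hasDerivWithinAt_const 0 _ (0 : ℝ)).congr (fun x hx => h x hx) (h 0 le_rfl)
  have := (uniqueDiffWithinAt_Iic (0 : ℝ)).eq_deriv _ h1 h2
  linarith

lemma stopLoss_eq_zero_of_pos (hD : IsBalanced D R) (h : ∀ x ∈ Set.Ioc 0 R, stopLoss D x = 0) :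
    ∀ x, 0 ≤ x → stopLoss D x = 0 := by
  have hpos : ∀ x, 0 < x → stopLoss D x = 0 := by
    intro x hx
    rcases le_or_gt x R with h' | h'
    · exact h x ⟨hx, h'⟩
    · exact hD.stopLoss_of_ge h'.le
  intro x hx
  rcases hx.lt_or_eq with hx | rfl
  · exact hpos x hx
  have hc := continuous_stopLoss hD.integrable hD.eq_zero
  have h1 : Filter.Tendsto (stopLoss D) (nhdsWithin 0 (Set.Ioi 0)) (nhds (stopLoss D 0)) :=
    hc.continuousAt.tendsto.mono_left nhdsWithin_le_nhds
  refine tendsto_nhds_unique h1 (Filter.Tendsto.congr' ?_ tendsto_const_nhds)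
  filter_upwards [self_mem_nhdsWithin] with x hx using (hpos x hx).symm

lemma stopLoss_eq_zero_of_neg (hD : IsBalanced D R)
    (h : ∀ x ∈ Set.Ioc 0 R, stopLoss D (-x) = 0) : ∀ x ≤ 0, stopLoss D x = 0 := by
  intro x hx
  have := hD.comp_neg.stopLoss_eq_zero_of_pos (fun x hx => by
    rw [hD.stopLoss_comp_neg]; exact h x hx) (-x) (by linarith)
  rwa [hD.stopLoss_comp_neg, neg_neg] at this

/-- Matching `p`-moments on both half-lines together with few sign changes forces the comparison
of `q`-moments on the positive half-line. -/
theorem posMoment_nonneg (hD : IsBalanced D R) {p q : ℝ} (hp : 1 < p) (hpq : p < q)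
    (hpos : posMoment p D = 0) (hneg : posMoment p (fun t => D (-t)) = 0)
    (alt : ∀ x₁ x₂ x₃ x₄ x₅, x₁ < x₂ → x₂ < x₃ → x₃ < x₄ → x₄ < x₅ →
      D x₁ < 0 → 0 < D x₂ → D x₃ < 0 → 0 < D x₄ → ¬ D x₅ < 0)
    (alt' : ∀ x₁ x₂ x₃ x₄, 0 < x₁ → x₁ < x₂ → x₂ < x₃ → x₃ < x₄ →
      0 < D x₁ → D x₂ < 0 → 0 < D x₃ → ¬ D x₄ < 0) :
    0 ≤ posMoment q D ∧ (posMoment q D = 0 → ∀ x, 0 ≤ x → stopLoss D x = 0) := by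
  have hc := continuous_stopLoss hD.integrable hD.eq_zero
  have hq : 1 < q := hp.trans hpq
  -- A passage from + to - on the positive half-line would make the transform nonnegative on the
  -- negative one, hence zero there by the matched p-moment. Starting with value and slope 0 at the
  -- origin, it would then need +,-,+,- in D on (0, ∞).
  have hno : ∀ x y, 0 < x → x < y → 0 < stopLoss D x → ¬ stopLoss D y < 0 := by
    intro x y hx hxy hGx hGy
    have hnn : ∀ z ∈ Set.Ioc 0 R, 0 ≤ stopLoss D (-z) := by
      intro z hz
      by_contra! h
      exact hD.stopLoss_alternation alt (by linarith [hz.1]) hxy h hGx hGy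
    have hz := hD.stopLoss_eq_zero_of_neg (eq_zero_of_integral_rpow_mul_eq_zero
      (G := fun z => stopLoss D (-z)) (hc.comp continuous_neg) hp hnn (by
      rw [hD.integral_rpow_mul_stopLoss_neg hp, hneg, zero_div]))
    have h0 := hD.tailIntegral_zero_of_nonpos hz
    have hz0 := hz 0 le_rfl
    obtain ⟨b, hb⟩ := exists_gt (max y R)
    have hyb := (le_max_left _ _).trans_lt hb
    have hRb := (le_max_right _ _).trans_lt hb
    have h0' := hD.stopLoss_of_ge hRb.le
    have k0' := hD.tailIntegral_of_ge hRb.le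
    obtain ⟨z₁, m₁, t₁⟩ := hD.tail_neg hx (by linarith)
    obtain ⟨z₂, m₂, t₂⟩ := hD.tail_pos hxy (by linarith)
    obtain ⟨z₃, m₃, t₃⟩ := hD.tail_neg hyb (by linarith)
    obtain ⟨s₁, n₁, u₁⟩ := hD.pos_of_tail m₁.1 (by linarith)
    obtain ⟨s₂, n₂, u₂⟩ := hD.neg_of_tail (m₁.2.trans m₂.1) (by linarith)
    obtain ⟨s₃, n₃, u₃⟩ := hD.pos_of_tail (m₂.2.trans m₃.1) (by linarith)
    obtain ⟨s₄, n₄, u₄⟩ := hD.neg_of_tail m₃.2 (by linarith)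
    exact alt' s₁ s₂ s₃ s₄ n₁.1 (n₁.2.trans n₂.1) (n₂.2.trans n₃.1) (n₃.2.trans n₄.1)
      u₁ u₂ u₃ u₄
  have key := single_crossing hc (R := R) hp hpq hno (by
    rw [integral_rpow_mul_stopLoss hp hD.integrable hD.eq_zero, hpos, zero_div])
  rw [integral_rpow_mul_stopLoss hq hD.integrable hD.eq_zero] at key
  have hqq : 0 < q * (q - 1) := mul_pos (by linarith) (by linarith)
  refine ⟨?_, fun h => ?_⟩
  · by_contra! hlt
    exact absurd key.1 (not_le.2 (div_neg_of_neg_of_pos hlt hqq))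
  exact hD.stopLoss_eq_zero_of_pos (key.2 (by rw [h, zero_div]))

/-- A one-sided comparison: with matching `p`-moments on the positive half-line and sign pattern
at most `-,+,-,+`, the `p`-moment on the negative half-line is nonpositive. -/
theorem posMoment_neg_nonpos (hD : IsBalanced D R) {p : ℝ} (hp : 1 < p)
    (hpos : posMoment p D = 0)
    (alt : ∀ x₁ x₂ x₃ x₄, x₁ < x₂ → x₂ < x₃ → x₃ < x₄ →
      0 < D x₁ → D x₂ < 0 → 0 < D x₃ → ¬ D x₄ < 0)
    (alt' : ∀ x₁ x₂ x₃, x₁ < x₂ → x₂ < x₃ → x₃ < 0 → 0 < D x₁ → D x₂ < 0 → ¬ 0 < D x₃) :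
    posMoment p (fun t => D (-t)) ≤ 0 := by
  have hc := continuous_stopLoss hD.integrable hD.eq_zero
  have hno : ∀ x y, x < y → 0 < stopLoss D x → ¬ stopLoss D y < 0 := by
    intro x y hxy hx hy
    obtain ⟨a, ha⟩ := exists_lt (min x (-R))
    obtain ⟨b, hb⟩ := exists_gt (max y R)
    have hax := ha.trans_le (min_le_left _ _)
    have haR := ha.trans_le (min_le_right _ _)
    have hyb := (le_max_left _ _).trans_lt hb
    have hRb := (le_max_right _ _).trans_lt hb
    have h0 := hD.stopLoss_of_le haR.le
    have h0' := hD.stopLoss_of_ge hRb.le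
    have k0 := hD.tailIntegral_of_le haR
    have k0' := hD.tailIntegral_of_ge hRb.le
    obtain ⟨z₁, m₁, t₁⟩ := hD.tail_neg hax (by linarith)
    obtain ⟨z₂, m₂, t₂⟩ := hD.tail_pos hxy (by linarith)
    obtain ⟨z₃, m₃, t₃⟩ := hD.tail_neg hyb (by linarith)
    obtain ⟨s₁, n₁, u₁⟩ := hD.pos_of_tail m₁.1 (by linarith)
    obtain ⟨s₂, n₂, u₂⟩ := hD.neg_of_tail (m₁.2.trans m₂.1) (by linarith)
    obtain ⟨s₃, n₃, u₃⟩ := hD.pos_of_tail (m₂.2.trans m₃.1) (by linarith)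
    obtain ⟨s₄, n₄, u₄⟩ := hD.neg_of_tail m₃.2 (by linarith)
    exact alt s₁ s₂ s₃ s₄ (n₁.2.trans n₂.1) (n₂.2.trans n₃.1) (n₃.2.trans n₄.1) u₁ u₂ u₃ u₄
  -- A positive value at some x < 0 makes the transform nonnegative on the positive half-line, hence
  -- zero there by the p-moment. Value and slope then vanish at 0 as well, which needs +,-,+ in D on
  -- the negative half-line.
  have hnp : ∀ x < 0, stopLoss D x ≤ 0 := by
    intro x hx0
    by_contra! hx
    have hnn : ∀ z ∈ Set.Ioc 0 R, 0 ≤ stopLoss D z := fun z hz =>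
      not_lt.1 (hno x z (hx0.trans hz.1) hx)
    have hz := hD.stopLoss_eq_zero_of_pos (eq_zero_of_integral_rpow_mul_eq_zero hc hp hnn (by
      rw [integral_rpow_mul_stopLoss hp hD.integrable hD.eq_zero, hpos, zero_div]))
    have h0 : tailIntegral D 0 = 0 := by
      have h1 := hD.comp_neg.tailIntegral_zero_of_nonpos (fun x hx => by
        rw [hD.stopLoss_comp_neg]; exact hz _ (by linarith))
      have h2 : tailIntegral (fun t => D (-t)) 0 = ∫ t in Set.Iic (0 : ℝ), D t := by
        rw [tailIntegral, integral_comp_neg_Ioi]; simp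
      have h3 := integral_add_compl (measurableSet_Ioi (a := (0 : ℝ))) hD.integrable
      rw [Set.compl_Ioi, ← h2, h1, hD.integral_eq, add_zero] at h3
      exact h3
    have hz0 := hz 0 le_rfl
    obtain ⟨a, ha⟩ := exists_lt (min x (-R))
    have hax := ha.trans_le (min_le_left _ _)
    have haR := ha.trans_le (min_le_right _ _)
    have h0' := hD.stopLoss_of_le haR.le
    have k0 := hD.tailIntegral_of_le haR
    obtain ⟨z₁, m₁, t₁⟩ := hD.tail_neg hax (by linarith)
    obtain ⟨z₂, m₂, t₂⟩ := hD.tail_pos hx0 (by linarith)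
    obtain ⟨s₁, n₁, u₁⟩ := hD.pos_of_tail m₁.1 (by linarith)
    obtain ⟨s₂, n₂, u₂⟩ := hD.neg_of_tail (m₁.2.trans m₂.1) (by linarith)
    obtain ⟨s₃, n₃, u₃⟩ := hD.pos_of_tail m₂.2 (by linarith)
    exact alt' s₁ s₂ s₃ (n₁.2.trans n₂.1) (n₂.2.trans n₃.1) n₃.2 u₁ u₂ u₃
  have key := hD.integral_rpow_mul_stopLoss_neg hp
  have hpp : 0 < p * (p - 1) := mul_pos (by linarith) (by linarith)
  have h1 : ∫ x in Set.Ioc 0 R, x ^ (p - 2) * stopLoss D (-x) ≤ 0 :=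
    setIntegral_nonpos measurableSet_Ioc fun x hx =>
      mul_nonpos_of_nonneg_of_nonpos (Real.rpow_nonneg hx.1.le _) (hnp _ (by linarith [hx.1]))
  rw [key] at h1
  by_contra! hcon
  exact absurd (div_pos hcon hpp) (not_lt.2 h1)

/-- A balanced function with vanishing stop-loss transform has vanishing tail integrals. -/
lemma tailIntegral_eq_zero (hD : IsBalanced D R) (h : ∀ x, stopLoss D x = 0) (z : ℝ) :
    tailIntegral D z = 0 := by
  have h1 := hD.hasDerivAt_stopLoss z
  rw [show stopLoss D = fun _ => 0 from funext h] at h1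
  linarith [h1.unique (hasDerivAt_const z 0)]

end IsBalanced

end SignChanges

/-! ### Comparison of a concave root with a two-sided convex root -/

section PowerDensity

/-- `φ ^ k` is a probability density on `[-R, R]` with mean zero. -/
structure IsCenteredPowDensity (k : ℕ) (R : ℝ) (φ : ℝ → ℝ) : Prop where
  ne_zero : k ≠ 0
  nonneg : ∀ t, 0 ≤ φ t
  eq_zero : ∀ t, R < |t| → φ t = 0
  integrable : Integrable fun t => φ t ^ k
  integral_eq : ∫ t, φ t ^ k = 1
  mean_eq : ∫ t, t * φ t ^ k = 0

/-- `φ` is concave where it is positive, and this set is convex. -/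
def ConcaveOnPos (φ : ℝ → ℝ) : Prop :=
  ∀ x z, 0 < φ x → 0 < φ z → ∀ l, 0 < l → l < 1 → (1 - l) * φ x + l * φ z ≤ φ ((1 - l) * x + l * z)

lemma ConcaveOnPos.comp_neg {φ : ℝ → ℝ} (h : ConcaveOnPos φ) : ConcaveOnPos fun t => φ (-t) := by
  intro x z hx hz l h0 h1
  convert h (-x) (-z) hx hz l h0 h1 using 2
  ring

/-- Excludes the pattern -,+,- of γ - φ wherever γ is convex: between x and z, φ lies above its
chord and γ below its own. -/
lemma ConcaveOnPos.le_of_convexOn {φ γ : ℝ → ℝ} {s : Set ℝ} (hφ : ConcaveOnPos φ)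
    (hγ : ConvexOn ℝ s γ) {x y z : ℝ} (hxs : x ∈ s) (hzs : z ∈ s) (hxy : x < y) (hyz : y < z)
    (hx : 0 < φ x) (hz : 0 < φ z) (hx' : γ x ≤ φ x) (hz' : γ z ≤ φ z) : γ y ≤ φ y := by
  have hxz : 0 < z - x := by linarith
  set l := (y - x) / (z - x) with hl
  have hl0 : 0 < l := div_pos (by linarith) hxz
  have hl1 : l < 1 := (div_lt_one hxz).2 (by linarith)
  have e : (1 - l) * x + l * z = y := by
    have : l * (z - x) = y - x := div_mul_cancel₀ _ hxz.ne'
    linarith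
  have h1 := hφ x z hx hz l hl0 hl1
  have h2 := hγ.2 hxs hzs (by linarith : 0 ≤ 1 - l) hl0.le (by ring)
  simp only [smul_eq_mul] at h2
  rw [e] at h1 h2
  have h3 := mul_le_mul_of_nonneg_left hx' (by linarith : 0 ≤ 1 - l)
  have h4 := mul_le_mul_of_nonneg_left hz' hl0.le
  linarith

namespace IsCenteredPowDensity

variable {k : ℕ} {R : ℝ} {φ γ : ℝ → ℝ}

lemma pow_eq_zero (hφ : IsCenteredPowDensity k R φ) (t : ℝ) (ht : R < |t|) : φ t ^ k = 0 := by
  rw [hφ.eq_zero t ht, zero_pow hφ.ne_zero]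

lemma comp_neg (hφ : IsCenteredPowDensity k R φ) : IsCenteredPowDensity k R fun t => φ (-t) where
  ne_zero := hφ.ne_zero
  nonneg t := hφ.nonneg _
  eq_zero t ht := hφ.eq_zero _ (by simpa using ht)
  integrable := hφ.integrable.comp_neg
  integral_eq := by rw [integral_neg_eq_self (fun t => φ t ^ k), hφ.integral_eq]
  mean_eq := by
    rw [← integral_neg_eq_self]
    simp only [neg_neg, neg_mul, integral_neg, hφ.mean_eq, neg_zero]

lemma integrable_mul (hφ : IsCenteredPowDensity k R φ) {h : ℝ → ℝ} (hh : Continuous h) :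
    Integrable fun t => h t * φ t ^ k :=
  integrable_continuous_mul_of_support hφ.integrable hφ.pow_eq_zero hh

lemma isBalanced_sub (hγ : IsCenteredPowDensity k R γ) (hφ : IsCenteredPowDensity k R φ) :
    IsBalanced (fun t => γ t ^ k - φ t ^ k) R where
  integrable := hγ.integrable.sub hφ.integrable
  eq_zero t ht := by rw [hγ.pow_eq_zero t ht, hφ.pow_eq_zero t ht, sub_zero]
  integral_eq := by rw [integral_sub hγ.integrable hφ.integrable, hγ.integral_eq, hφ.integral_eq,
    sub_self]
  mean_eq := by
    simp only [mul_sub]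
    rw [integral_sub (hγ.integrable_mul continuous_id') (hφ.integrable_mul continuous_id'),
      hγ.mean_eq, hφ.mean_eq, sub_self]

lemma continuous_posPart_rpow {p : ℝ} (hp : 0 ≤ p) : Continuous fun t : ℝ => max t 0 ^ p :=
  (continuous_id.max continuous_const).rpow_const fun _ => Or.inr hp

lemma posMoment_sub (hγ : IsCenteredPowDensity k R γ) (hφ : IsCenteredPowDensity k R φ) {p : ℝ}
    (hp : 0 ≤ p) : posMoment p (fun t => γ t ^ k - φ t ^ k) =
      posMoment p (fun t => γ t ^ k) - posMoment p (fun t => φ t ^ k) := by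
  simp only [posMoment, mul_sub]
  exact integral_sub (hγ.integrable_mul (continuous_posPart_rpow hp))
    (hφ.integrable_mul (continuous_posPart_rpow hp))

/-- Otherwise -t φ^k would be nonnegative with zero integral, so φ^k would vanish almost everywhere,
against total mass 1. -/
lemma not_ae_eq_zero (hφ : IsCenteredPowDensity k R φ) : ¬ ∀ᵐ t, 0 < t → φ t = 0 := by
  intro h
  have h1 : 0 ≤ᵐ[volume] fun t => -(t * φ t ^ k) := by
    filter_upwards [h] with t ht
    rcases lt_or_ge 0 t with h0 | h0
    · simp [ht h0, hφ.ne_zero]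
    · have := mul_nonneg (neg_nonneg.2 h0) (pow_nonneg (hφ.nonneg t) k)
      simpa using this
  have h2 := (integral_eq_zero_iff_of_nonneg_ae h1 (hφ.integrable_mul continuous_id').neg).1
    (by rw [integral_neg, hφ.mean_eq, neg_zero])
  have h3 : (fun t => φ t ^ k) =ᵐ[volume] 0 := by
    have h0 : ∀ᵐ t : ℝ, t ≠ 0 := by simp [ae_iff]
    filter_upwards [h2, h0] with t ht ht0
    simpa [ht0] using ht
  have := hφ.integral_eq
  rw [integral_congr_ae h3] at this
  simp at this

lemma posMoment_pos (hφ : IsCenteredPowDensity k R φ) {p : ℝ} (hp : 0 < p) :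
    0 < posMoment p fun t => φ t ^ k := by
  have h0 : 0 ≤ᵐ[volume] fun t => max t 0 ^ p * φ t ^ k := Filter.Eventually.of_forall fun t =>
    mul_nonneg (Real.rpow_nonneg (le_max_right _ _) _) (pow_nonneg (hφ.nonneg t) k)
  refine lt_of_le_of_ne (integral_nonneg_of_ae h0) fun h => hφ.not_ae_eq_zero ?_
  have := (integral_eq_zero_iff_of_nonneg_ae h0
    (hφ.integrable_mul (continuous_posPart_rpow hp.le))).1 h.symm
  filter_upwards [this] with t ht ht0
  have h1 : max t 0 ^ p ≠ 0 := (Real.rpow_pos_of_pos (by simpa using ht0) _).ne'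
  simpa [h1, hφ.ne_zero] using ht

/-- If γ > φ wherever φ > 0 on the half-line, equal p-moments would fail. The resulting point acts
as an additional "minus" of γ - φ when sign patterns are ruled out on the other half-line. -/
lemma exists_pos_le (hφ : IsCenteredPowDensity k R φ) (hγ : IsCenteredPowDensity k R γ) {p : ℝ}
    (hp : 0 < p) (h : posMoment p (fun t => γ t ^ k) = posMoment p (fun t => φ t ^ k)) :
    ∃ x, 0 < x ∧ 0 < φ x ∧ γ x ≤ φ x := by
  by_contra! hn
  have hlt : ∀ t, 0 < t → φ t ≤ γ t := fun t ht => by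
    rcases (hφ.nonneg t).lt_or_eq with h0 | h0
    · exact (hn t ht h0).le
    · rw [← h0]; exact hγ.nonneg t
  have h0 : 0 ≤ᵐ[volume] fun t => max t 0 ^ p * (γ t ^ k - φ t ^ k) :=
    Filter.Eventually.of_forall fun t => by
      simp only [Pi.zero_apply]
      rcases lt_or_ge 0 t with ht | ht
      · exact mul_nonneg (Real.rpow_nonneg (le_max_right _ _) _)
          (sub_nonneg.2 (pow_le_pow_left₀ (hφ.nonneg t) (hlt t ht) k))
      · rw [max_eq_right ht, Real.zero_rpow hp.ne', zero_mul]
  have hD := hγ.isBalanced_sub hφ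
  have := (integral_eq_zero_iff_of_nonneg_ae h0 (integrable_continuous_mul_of_support
    hD.integrable hD.eq_zero (continuous_posPart_rpow hp.le))).1
    ((hγ.posMoment_sub hφ hp.le).trans (by rw [h, sub_self]))
  refine hφ.not_ae_eq_zero ?_
  filter_upwards [this] with t ht ht0
  have h1 : max t 0 ^ p ≠ 0 := (Real.rpow_pos_of_pos (by simpa using ht0) _).ne'
  have h2 : γ t ^ k - φ t ^ k = 0 := by simpa [h1] using ht
  by_contra h3
  have h4 := hn t ht0 (lt_of_le_of_ne (hφ.nonneg t) (Ne.symm h3))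
  have := pow_lt_pow_left₀ h4 (hφ.nonneg t) hφ.ne_zero
  linarith

lemma sub_neg_iff (hφ : IsCenteredPowDensity k R φ) (hγ : IsCenteredPowDensity k R γ) (t : ℝ) :
    γ t ^ k - φ t ^ k < 0 ↔ γ t < φ t := by
  rw [sub_neg, pow_lt_pow_iff_left₀ (hγ.nonneg t) (hφ.nonneg t) hφ.ne_zero]

lemma sub_pos_iff (hφ : IsCenteredPowDensity k R φ) (hγ : IsCenteredPowDensity k R γ) (t : ℝ) :
    0 < γ t ^ k - φ t ^ k ↔ φ t < γ t := by
  rw [sub_pos, pow_lt_pow_iff_left₀ (hφ.nonneg t) (hγ.nonneg t) hφ.ne_zero]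

/-- In a pattern -,+,-,+,- the middle point lies on one side of m, and with it three consecutive
points -,+,-, which is impossible. A pattern +,-,+,- on (0, ∞) is extended to the left by the point
-x₀ and excluded in the same way. -/
theorem posMoment_le (hφ : IsCenteredPowDensity k R φ) (hγ : IsCenteredPowDensity k R γ)
    (hc : ConcaveOnPos φ) {m : ℝ} (hl : ConvexOn ℝ (Set.Iic m) γ) (hr : ConvexOn ℝ (Set.Ici m) γ)
    {p q : ℝ} (hp : 1 < p) (hpq : p < q)
    (hpos : posMoment p (fun t => γ t ^ k) = posMoment p (fun t => φ t ^ k))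
    (hneg : posMoment p (fun t => γ (-t) ^ k) = posMoment p (fun t => φ (-t) ^ k)) :
    posMoment q (fun t => φ t ^ k) ≤ posMoment q (fun t => γ t ^ k) ∧
      (posMoment q (fun t => φ t ^ k) = posMoment q (fun t => γ t ^ k) →
        ∀ x, 0 ≤ x → stopLoss (fun t => γ t ^ k - φ t ^ k) x = 0) := by
  have hp0 : 0 ≤ p := by linarith
  have hq0 : 0 ≤ q := by linarith
  obtain ⟨x₀, hx₀, hφx₀, hγx₀⟩ := hφ.comp_neg.exists_pos_le hγ.comp_neg (by linarith) hneg
  have key := (hγ.isBalanced_sub hφ).posMoment_nonneg hp hpq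
    (by rw [hγ.posMoment_sub hφ hp0, hpos, sub_self])
    (by rw [hγ.comp_neg.posMoment_sub hφ.comp_neg hp0, hneg, sub_self]) ?_ ?_
  · rw [hγ.posMoment_sub hφ hq0, sub_nonneg, sub_eq_zero] at key
    exact ⟨key.1, fun h => key.2 h.symm⟩
  · simp only [hφ.sub_neg_iff hγ, hφ.sub_pos_iff hγ]
    intro x₁ x₂ x₃ x₄ x₅ h12 h23 h34 h45 d1 d2 d3 d4 d5
    have p1 := (hγ.nonneg _).trans_lt d1
    have p3 := (hγ.nonneg _).trans_lt d3
    have p5 := (hγ.nonneg _).trans_lt d5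
    rcases le_total x₃ m with h | h
    · exact absurd (hc.le_of_convexOn hl (Set.mem_Iic.2 ((h12.trans h23).le.trans h)) h h12 h23
        p1 p3 d1.le d3.le) (not_le.2 d2)
    · exact absurd (hc.le_of_convexOn hr h (Set.mem_Ici.2 (h.trans (h34.trans h45).le)) h34 h45
        p3 p5 d3.le d5.le) (not_le.2 d4)
  · simp only [hφ.sub_neg_iff hγ, hφ.sub_pos_iff hγ]
    intro x₁ x₂ x₃ x₄ h01 h12 h23 h34 d1 d2 d3 d4
    have p2 := (hγ.nonneg _).trans_lt d2
    have p4 := (hγ.nonneg _).trans_lt d4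
    rcases le_total x₂ m with h | h
    · have h0 : -x₀ < x₁ := by linarith
      exact absurd (hc.le_of_convexOn hl (Set.mem_Iic.2 ((h0.trans h12).le.trans h)) h h0 h12
        hφx₀ p2 hγx₀ d2.le) (not_le.2 d1)
    · exact absurd (hc.le_of_convexOn hr h (Set.mem_Ici.2 (h.trans (h23.trans h34).le)) h23 h34
        p2 p4 d2.le d4.le) (not_le.2 d3)

/-- If `φ ^ k` has the same `p`-moments on the two half-lines as `γ ^ k`, where `φ` is concave
and `γ` is convex on each side of a point, then its `q`-moments are smaller. -/
theorem posMoment_le_and_eq (hφ : IsCenteredPowDensity k R φ) (hγ : IsCenteredPowDensity k R γ)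
    (hc : ConcaveOnPos φ) {m : ℝ} (hl : ConvexOn ℝ (Set.Iic m) γ) (hr : ConvexOn ℝ (Set.Ici m) γ)
    {p q : ℝ} (hp : 1 < p) (hpq : p < q)
    (hpos : posMoment p (fun t => γ t ^ k) = posMoment p (fun t => φ t ^ k))
    (hneg : posMoment p (fun t => γ (-t) ^ k) = posMoment p (fun t => φ (-t) ^ k)) :
    posMoment q (fun t => φ t ^ k) ≤ posMoment q (fun t => γ t ^ k) ∧
    posMoment q (fun t => φ (-t) ^ k) ≤ posMoment q (fun t => γ (-t) ^ k) ∧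
      (posMoment q (fun t => φ t ^ k) = posMoment q (fun t => γ t ^ k) →
        posMoment q (fun t => φ (-t) ^ k) = posMoment q (fun t => γ (-t) ^ k) →
        ∀ z, ∫ t in Set.Ioi z, φ t ^ k = ∫ t in Set.Ioi z, γ t ^ k) := by
  have hD := hγ.isBalanced_sub hφ
  have h1 := hφ.posMoment_le hγ hc hl hr hp hpq hpos hneg
  have hl' : ConvexOn ℝ (Set.Ici (-m)) fun t => γ (-t) := by
    refine (hl.comp_linearMap (-LinearMap.id)).subset (fun t ht => ?_) (convex_Ici _)
    have ht' : -m ≤ t := ht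
    simpa using (by linarith : -t ≤ m)
  have hr' : ConvexOn ℝ (Set.Iic (-m)) fun t => γ (-t) := by
    refine (hr.comp_linearMap (-LinearMap.id)).subset (fun t ht => ?_) (convex_Iic _)
    have ht' : t ≤ -m := ht
    simpa using (by linarith : m ≤ -t)
  have h2 := hφ.comp_neg.posMoment_le hγ.comp_neg hc.comp_neg hr' hl' hp hpq hneg
    (by simpa using hpos)
  refine ⟨h1.1, h2.1, fun e1 e2 z => ?_⟩
  have h3 := hD.tailIntegral_eq_zero (fun x => ?_) z
  · rw [tailIntegral, integral_sub hγ.integrable.integrableOn hφ.integrable.integrableOn] at h3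
    linarith
  -- The transform of D vanishes for x ≥ 0 by the comparison itself, and for x ≤ 0 by the comparison
  -- of the reflected densities.
  · rcases le_total 0 x with h | h
    · exact h1.2 e1 x h
    · have := h2.2 e2 (-x) (by linarith)
      rwa [hD.stopLoss_comp_neg, neg_neg] at this

/-- If `φ ^ k` has the same positive `p`-moment as a density `γ ^ k` whose root vanishes left of
`m` and is convex from `m` on, then its negative `p`-moment is larger. -/
theorem posMoment_neg_le (hφ : IsCenteredPowDensity k R φ) (hγ : IsCenteredPowDensity k R γ)
    (hc : ConcaveOnPos φ) {m : ℝ} (hl : ∀ t < m, γ t = 0) (hr : ConvexOn ℝ (Set.Ici m) γ)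
    {p : ℝ} (hp : 1 < p)
    (hpos : posMoment p (fun t => γ t ^ k) = posMoment p (fun t => φ t ^ k)) :
    posMoment p (fun t => γ (-t) ^ k) ≤ posMoment p (fun t => φ (-t) ^ k) := by
  have hp0 : 0 ≤ p := by linarith
  obtain ⟨x₀, hx₀, hφx₀, hγx₀⟩ := hφ.exists_pos_le hγ (by linarith) hpos
  have hm : ∀ t, φ t < γ t → m ≤ t := fun t ht => by
    by_contra! h
    rw [hl t h] at ht
    exact absurd ht (not_lt.2 (hφ.nonneg t))
  -- By `hm` the first "plus" already lies in [m, ∞), so all later points lie where γ is convex. For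
  -- +,-,+ on the negative half-line, x₀ > 0 supplies the closing "minus".
  have key := (hγ.isBalanced_sub hφ).posMoment_neg_nonpos hp
    (by rw [hγ.posMoment_sub hφ hp0, hpos, sub_self]) ?_ ?_
  · rw [hγ.comp_neg.posMoment_sub hφ.comp_neg hp0] at key
    linarith
  · simp only [hφ.sub_neg_iff hγ, hφ.sub_pos_iff hγ]
    intro x₁ x₂ x₃ x₄ h12 h23 h34 d1 d2 d3 d4
    have h := hm x₁ d1
    exact absurd (hc.le_of_convexOn hr (Set.mem_Ici.2 (h.trans h12.le))
      (Set.mem_Ici.2 (h.trans (h12.trans (h23.trans h34)).le)) h23 h34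
      ((hγ.nonneg _).trans_lt d2) ((hγ.nonneg _).trans_lt d4) d2.le d4.le) (not_le.2 d3)
  · simp only [hφ.sub_neg_iff hγ, hφ.sub_pos_iff hγ]
    intro x₁ x₂ x₃ h12 h23 h3 d1 d2 d3
    have h := hm x₁ d1
    have h30 : x₃ < x₀ := h3.trans hx₀
    exact absurd (hc.le_of_convexOn hr (Set.mem_Ici.2 (h.trans h12.le))
      (Set.mem_Ici.2 (h.trans (h12.trans (h23.trans h30)).le)) h23 h30
      ((hγ.nonneg _).trans_lt d2) hφx₀ d2.le hγx₀) (not_le.2 d3)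

end IsCenteredPowDensity

end PowerDensity

/-! ### Densities of marginals through slice volumes; Brunn's theorem -/

section Slices

open Measure in
-- The image of Lebesgue measure is a positive multiple of Lebesgue measure, and the constant
-- cancels in the normalization. Hence any linear coordinates serve, orthonormal or not.
lemma map_cond_continuousLinearEquiv {E F : Type*} [NormedAddCommGroup E] [NormedSpace ℝ E]
    [FiniteDimensional ℝ E] [MeasureSpace E] [BorelSpace E] [(volume : Measure E).IsAddHaarMeasure]
    [NormedAddCommGroup F] [NormedSpace ℝ F] [FiniteDimensional ℝ F] [MeasureSpace F]
    [BorelSpace F] [(volume : Measure F).IsAddHaarMeasure] (e : E ≃L[ℝ] F) (K : Set E) :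
    (cond volume K).map e = cond volume (e '' K) := by
  have hF : (volume.map e : Measure F) =
      addHaarScalarFactor (volume.map e) volume • (volume : Measure F) :=
    isAddLeftInvariant_eq_smul _ _
  have hpos : 0 < addHaarScalarFactor (volume.map e) (volume : Measure F) :=
    addHaarScalarFactor_pos_of_isAddHaarMeasure _ _
  set c := addHaarScalarFactor (volume.map e) (volume : Measure F)
  have hemb : MeasurableEmbedding e := e.toHomeomorph.measurableEmbedding
  have h1 : volume K = c * volume (e '' K) := by
    have := congrArg (fun μ => μ (e '' K)) hF
    rw [hemb.map_apply, Set.preimage_image_eq _ e.injective] at this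
    rw [this]; rfl
  have h2 : (volume.restrict K).map e = c • volume.restrict (e '' K) := by
    rw [← Measure.restrict_smul, ← hF, hemb.restrict_map, Set.preimage_image_eq _ e.injective]
  have hc0 : (c : ENNReal) ≠ 0 := by exact_mod_cast hpos.ne'
  rw [ProbabilityTheory.cond, ProbabilityTheory.cond, Measure.map_smul, h2, h1,
    ENNReal.mul_inv (Or.inl hc0) (Or.inl ENNReal.coe_ne_top)]
  ext s hs
  simp only [Measure.smul_apply, smul_eq_mul, ENNReal.smul_def]
  rw [mul_comm (c : ENNReal)⁻¹, mul_assoc, ← mul_assoc (c : ENNReal)⁻¹,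
    ENNReal.inv_mul_cancel hc0 ENNReal.coe_ne_top, one_mul]

/-- The `k`-th root of the density of the first coordinate of a uniform point of `K`. -/
noncomputable def sliceRoot {k : ℕ} (K : Set (ℝ × (Fin k → ℝ))) (t : ℝ) : ℝ :=
  ((volume K).toReal⁻¹ * (volume (Prod.mk t ⁻¹' K)).toReal) ^ (1 / k : ℝ)

variable {k : ℕ} {K : Set (ℝ × (Fin k → ℝ))}

lemma sliceRoot_nonneg (t : ℝ) : 0 ≤ sliceRoot K t := by unfold sliceRoot; positivity

lemma sliceRoot_pow (hk : k ≠ 0) (t : ℝ) :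
    sliceRoot K t ^ k = (volume K).toReal⁻¹ * (volume (Prod.mk t ⁻¹' K)).toReal := by
  have hk' : (k : ℝ) ≠ 0 := by exact_mod_cast hk
  rw [sliceRoot, ← Real.rpow_natCast, ← Real.rpow_mul (by positivity)]
  simp [hk']

lemma sliceRoot_eq_zero (hk : k ≠ 0) {t : ℝ} (h : volume (Prod.mk t ⁻¹' K) = 0) :
    sliceRoot K t = 0 := by
  have hk' : (k : ℝ) ≠ 0 := by exact_mod_cast hk
  simp [sliceRoot, h, hk']

lemma isCompact_slice (hK : IsCompact K) (t : ℝ) : IsCompact (Prod.mk t ⁻¹' K) := by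
  have : Prod.mk t ⁻¹' K = Prod.snd '' (K ∩ Prod.fst ⁻¹' {t}) := by
    ext y
    constructor
    · intro hy; exact ⟨(t, y), ⟨hy, rfl⟩, rfl⟩
    · rintro ⟨⟨s, z⟩, ⟨h1, h2⟩, rfl⟩
      have : s = t := h2
      subst this; exact h1
  rw [this]
  exact (hK.inter_right (isClosed_singleton.preimage continuous_fst)).image continuous_snd

/-- Brunn's theorem: by convexity, combinations of two slices lie in the intermediate slice, and
Brunn–Minkowski applies to slices of positive volume. -/
lemma concaveOnPos_sliceRoot (hk : k ≠ 0) (hK : IsCompact K) (hconv : Convex ℝ K) :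
    ConcaveOnPos (sliceRoot K) := by
  intro x z hx hz l hl0 hl1
  have hk' : (k : ℝ) ≠ 0 := by exact_mod_cast hk
  have hl1' : 0 < 1 - l := by linarith
  set V := (volume K).toReal⁻¹ with hV
  have hV0 : 0 ≤ V := by positivity
  set s : ℝ → ℝ := fun t => (volume (Prod.mk t ⁻¹' K)).toReal ^ (1 / k : ℝ) with hs
  have hs0 : ∀ t, 0 ≤ s t := fun t => by positivity
  have e : ∀ t, sliceRoot K t = V ^ (1 / k : ℝ) * s t := fun t =>
    Real.mul_rpow hV0 ENNReal.toReal_nonneg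
  have hsk : ∀ t, volume (Prod.mk t ⁻¹' K) = ENNReal.ofReal (s t ^ k) := by
    intro t
    rw [hs]
    simp only
    rw [← Real.rpow_natCast, ← Real.rpow_mul ENNReal.toReal_nonneg]
    simp [hk', (isCompact_slice hK t).measure_lt_top.ne]
  have hpos : ∀ t, 0 < sliceRoot K t → 0 < s t := fun t ht => by
    rcases (hs0 t).lt_or_eq with h | h
    · exact h
    · rw [e, ← h, mul_zero] at ht; exact absurd ht (lt_irrefl _)
  have key := brunn_minkowski (isCompact_slice hK x).measurableSet
    (isCompact_slice hK z).measurableSet (isCompact_slice hK ((1 - l) * x + l * z)).measurableSet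
    hl0 hl1 (hpos x hx) (hpos z hz) (hsk x) (hsk z) (by
      intro a ha b hb
      have := hconv ha hb hl1'.le hl0.le (by ring)
      simpa using this)
  rw [hsk, ENNReal.ofReal_le_ofReal_iff (pow_nonneg (hs0 _) _)] at key
  have key2 := (pow_le_pow_iff_left₀ (add_nonneg (mul_nonneg hl1'.le (hs0 x))
    (mul_nonneg hl0.le (hs0 z))) (hs0 _) hk).1 key
  rw [e, e, e]
  have := mul_le_mul_of_nonneg_left key2 (Real.rpow_nonneg hV0 (1 / k : ℝ))
  linarith

lemma map_fst_cond (hk : k ≠ 0) (hK : IsCompact K) (h0 : volume K ≠ 0) :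
    (cond volume K).map Prod.fst =
      volume.withDensity fun t => ENNReal.ofReal (sliceRoot K t ^ k) := by
  have hfin : volume K ≠ ⊤ := hK.measure_lt_top.ne
  ext B hB
  rw [Measure.map_apply measurable_fst hB, cond_apply hK.measurableSet, withDensity_apply _ hB,
    Measure.volume_eq_prod, Measure.prod_apply (hK.measurableSet.inter (measurable_fst hB)),
    ← lintegral_const_mul _ (measurable_measure_prodMk_left
      (hK.measurableSet.inter (measurable_fst hB))), ← lintegral_indicator hB]
  refine lintegral_congr fun t => ?_
  by_cases ht : t ∈ B
  · have : Prod.mk t ⁻¹' (K ∩ Prod.fst ⁻¹' B) = Prod.mk t ⁻¹' K := by ext y; simp [ht]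
    rw [this, Set.indicator_of_mem ht, sliceRoot_pow hk, ENNReal.ofReal_mul (by positivity),
      ENNReal.ofReal_inv_of_pos (ENNReal.toReal_pos h0 hfin), ENNReal.ofReal_toReal hfin,
      ENNReal.ofReal_toReal (isCompact_slice hK t).measure_lt_top.ne]
    rfl
  · have : Prod.mk t ⁻¹' (K ∩ Prod.fst ⁻¹' B) = ∅ := by ext y; simp [ht]
    rw [this, Set.indicator_of_notMem ht]; simp

lemma measurable_sliceRoot (hK : IsCompact K) : Measurable (sliceRoot K) := by
  unfold sliceRoot
  exact ((measurable_measure_prodMk_left hK.measurableSet).ennreal_toReal.const_mul _).pow_const _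

lemma exists_sliceRoot_eq_zero (hk : k ≠ 0) (hK : IsCompact K) :
    ∃ R, ∀ t, R < |t| → sliceRoot K t = 0 := by
  obtain ⟨R, hR⟩ := hK.isBounded.exists_norm_le
  refine ⟨R, fun t ht => sliceRoot_eq_zero hk ?_⟩
  have : Prod.mk t ⁻¹' K = ∅ := by
    ext y
    simp only [Set.mem_preimage, Set.mem_empty_iff_false, iff_false]
    intro hy
    have h1 := (norm_fst_le (t, y)).trans (hR _ hy)
    rw [Real.norm_eq_abs] at h1
    linarith
  simp [this]

/-- A homothety of ratio r multiplies k-dimensional volume by r^k, so the k-th root is linear in r;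
this makes tents piecewise affine. -/
lemma sliceRoot_homothety (hk : k ≠ 0) {s t r : ℝ} (hr : 0 ≤ r) (y : Fin k → ℝ)
    (h : Prod.mk t ⁻¹' K = AffineMap.homothety y r '' (Prod.mk s ⁻¹' K)) :
    sliceRoot K t = r * sliceRoot K s := by
  have hk' : (k : ℝ) ≠ 0 := by exact_mod_cast hk
  have h1 : (volume (Prod.mk t ⁻¹' K)).toReal = r ^ k * (volume (Prod.mk s ⁻¹' K)).toReal := by
    rw [h, Measure.addHaar_image_homothety, ENNReal.toReal_mul,
      ENNReal.toReal_ofReal (abs_nonneg _), abs_of_nonneg (by positivity)]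
    simp
  rw [sliceRoot, sliceRoot, h1, mul_left_comm, Real.mul_rpow (by positivity) (by positivity)]
  congr 1
  rw [← Real.rpow_natCast, ← Real.rpow_mul hr]
  simp [hk']

end Slices

/-! ### Convex bodies and coordinates adapted to a direction -/

section Bodies

variable {n : ℕ}

lemma IsConvexBody.volume_ne_zero {K : Set (EuclideanSpace ℝ (Fin n))} (hK : IsConvexBody K) :
    volume K ≠ 0 := (Measure.measure_pos_of_nonempty_interior _ hK.nonempty_interior).ne'

lemma IsConvexBody.isProbabilityMeasure {K : Set (EuclideanSpace ℝ (Fin n))}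
    (hK : IsConvexBody K) : IsProbabilityMeasure (uniformLaw K) :=
  cond_isProbabilityMeasure_of_finite hK.volume_ne_zero hK.isCompact.measure_lt_top.ne

/-- The inner product with θ replaces a coordinate i with θ i ≠ 0, and the other coordinates are
kept. -/
lemma exists_continuousLinearEquiv_fst_eq_inner {k : ℕ} {θ : EuclideanSpace ℝ (Fin (k + 1))}
    (hθ : θ ≠ 0) : ∃ e : EuclideanSpace ℝ (Fin (k + 1)) ≃L[ℝ] ℝ × (Fin k → ℝ),
      ∀ x, (e x).1 = inner ℝ x θ := by
  obtain ⟨i, hi⟩ : ∃ i, θ i ≠ 0 := by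
    by_contra! h
    exact hθ (by ext i; simpa using h i)
  let A : EuclideanSpace ℝ (Fin (k + 1)) →ₗ[ℝ] ℝ × (Fin k → ℝ) :=
    { toFun := fun x => (inner ℝ x θ, fun j => x (i.succAbove j))
      map_add' := fun x y => by ext <;> simp [inner_add_left]
      map_smul' := fun c x => by ext <;> simp [inner_smul_left] }
  have hA : Function.Injective A := by
    rw [injective_iff_map_eq_zero]
    intro x hx
    have h1 : inner ℝ x θ = 0 := congrArg Prod.fst hx
    have h2 : ∀ j, x (i.succAbove j) = 0 := fun j => congrFun (congrArg Prod.snd hx) j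
    rw [PiLp.inner_apply, Fin.sum_univ_succAbove _ i] at h1
    simp only [h2] at h1
    have h3 : x i = 0 := by simpa [hi] using h1
    ext l
    rcases eq_or_ne l i with rfl | hl
    · simpa using h3
    · obtain ⟨j, rfl⟩ := Fin.exists_succAbove_eq hl
      simpa using h2 j
  refine ⟨(LinearMap.linearEquivOfInjective A hA (by simp [add_comm])).toContinuousLinearEquiv,
    fun x => rfl⟩

lemma marginalLaw_eq_map {k : ℕ} {θ : EuclideanSpace ℝ (Fin (k + 1))}
    (e : EuclideanSpace ℝ (Fin (k + 1)) ≃L[ℝ] ℝ × (Fin k → ℝ)) (he : ∀ x, (e x).1 = inner ℝ x θ)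
    (K : Set (EuclideanSpace ℝ (Fin (k + 1)))) :
    marginalLaw K θ = (cond volume (e '' K)).map Prod.fst := by
  have : (volume : Measure (ℝ × (Fin k → ℝ))).IsAddHaarMeasure := by
    rw [Measure.volume_eq_prod]; infer_instance
  rw [← map_cond_continuousLinearEquiv e K, Measure.map_map measurable_fst e.continuous.measurable,
    marginalLaw, uniformLaw]
  congr 1
  ext x
  exact (he x).symm

end Bodies

/-! ### Half-line moments of marginals -/

section BodyMoments

/-- The moment `E (X · θ)₊ ^ p` for `X` uniform on `K`. -/
noncomputable def bodyMoment {n : ℕ} (p : ℝ) (K : Set (EuclideanSpace ℝ (Fin n)))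
    (θ : EuclideanSpace ℝ (Fin n)) : ℝ :=
  ∫ x, max (inner ℝ x θ) 0 ^ p ∂(uniformLaw K)

lemma IsCenteredPowDensity.mono {k : ℕ} {R R' : ℝ} {φ : ℝ → ℝ} (h : IsCenteredPowDensity k R φ)
    (hR : R ≤ R') : IsCenteredPowDensity k R' φ :=
  { h with eq_zero := fun t ht => h.eq_zero t (hR.trans_lt ht) }

lemma IsConvexBody.integrable_uniformLaw {n : ℕ} {K : Set (EuclideanSpace ℝ (Fin n))}
    (hK : IsConvexBody K) {F : Type*} [NormedAddCommGroup F] {h : EuclideanSpace ℝ (Fin n) → F}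
    (hh : Continuous h) : Integrable h (uniformLaw K) := by
  unfold uniformLaw ProbabilityTheory.cond
  refine Integrable.smul_measure ?_ (by simp [hK.volume_ne_zero])
  exact hh.continuousOn.integrableOn_compact hK.isCompact

lemma IsConvexBody.integral_inner_eq_zero {n : ℕ} {K : Set (EuclideanSpace ℝ (Fin n))}
    (hK : IsConvexBody K) (hK0 : IsCentered K) (θ : EuclideanSpace ℝ (Fin n)) :
    ∫ x, inner ℝ x θ ∂(uniformLaw K) = 0 := by
  have := integral_inner (𝕜 := ℝ) (hK.integrable_uniformLaw continuous_id) θ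
  simp only [id] at this
  simp_rw [real_inner_comm]
  rw [this, hK0, inner_zero_right]

variable {k : ℕ} {K : Set (EuclideanSpace ℝ (Fin (k + 1)))} {θ : EuclideanSpace ℝ (Fin (k + 1))}
  {e : EuclideanSpace ℝ (Fin (k + 1)) ≃L[ℝ] ℝ × (Fin k → ℝ)}

lemma IsConvexBody.volume_image_ne_zero (hK : IsConvexBody K) : volume (e '' K) ≠ 0 := by
  have : (volume : Measure (ℝ × (Fin k → ℝ))).IsAddHaarMeasure := by
    rw [Measure.volume_eq_prod]; infer_instance
  refine (Measure.measure_pos_of_nonempty_interior _ ?_).ne'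
  have h := (hK.nonempty_interior).image e.toHomeomorph
  rw [e.toHomeomorph.image_interior] at h
  exact h

lemma IsConvexBody.marginalLaw_eq_withDensity (hK : IsConvexBody K) (hk : k ≠ 0)
    (he : ∀ x, (e x).1 = inner ℝ x θ) : marginalLaw K θ =
      volume.withDensity fun t => ENNReal.ofReal (sliceRoot (e '' K) t ^ k) := by
  rw [marginalLaw_eq_map e he K,
    map_fst_cond hk (hK.isCompact.image e.continuous) hK.volume_image_ne_zero]

lemma IsConvexBody.integral_comp_inner (hK : IsConvexBody K) (hk : k ≠ 0)
    (he : ∀ x, (e x).1 = inner ℝ x θ) {h : ℝ → ℝ} (hh : Continuous h) :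
    ∫ x, h (inner ℝ x θ) ∂(uniformLaw K) = ∫ t, h t * sliceRoot (e '' K) t ^ k := by
  have h1 : ∫ x, h (inner ℝ x θ) ∂(uniformLaw K) = ∫ t, h t ∂(marginalLaw K θ) := by
    rw [marginalLaw, integral_map (by fun_prop) hh.aestronglyMeasurable]
  rw [h1, hK.marginalLaw_eq_withDensity hk he, integral_withDensity_eq_integral_toReal_smul
    ((measurable_sliceRoot (hK.isCompact.image e.continuous)).pow_const k).ennreal_ofReal
    (Filter.Eventually.of_forall fun t => ENNReal.ofReal_lt_top)]
  congr 1; ext t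
  rw [ENNReal.toReal_ofReal (pow_nonneg (sliceRoot_nonneg t) k), smul_eq_mul, mul_comm]

lemma IsConvexBody.exists_isCenteredPowDensity (hK : IsConvexBody K) (hK0 : IsCentered K)
    (hk : k ≠ 0) (he : ∀ x, (e x).1 = inner ℝ x θ) :
    ∃ R, IsCenteredPowDensity k R (sliceRoot (e '' K)) := by
  have hc := hK.isCompact.image e.continuous
  obtain ⟨R, hR⟩ := exists_sliceRoot_eq_zero hk hc
  have hprob := hK.isProbabilityMeasure
  have hl : ∫⁻ t, ENNReal.ofReal (sliceRoot (e '' K) t ^ k) = 1 := by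
    have h1 : marginalLaw K θ Set.univ = 1 := by
      rw [marginalLaw, Measure.map_apply (by fun_prop) MeasurableSet.univ]; simp
    rw [hK.marginalLaw_eq_withDensity hk he] at h1
    simpa using h1
  have hnn : ∀ t, 0 ≤ sliceRoot (e '' K) t ^ k := fun t => pow_nonneg (sliceRoot_nonneg t) k
  have hm : Measurable fun t => sliceRoot (e '' K) t ^ k := (measurable_sliceRoot hc).pow_const k
  refine ⟨R, hk, sliceRoot_nonneg, hR, ⟨hm.aestronglyMeasurable, ?_⟩, ?_, ?_⟩
  · rw [hasFiniteIntegral_iff_ofReal (Filter.Eventually.of_forall hnn), hl]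
    exact ENNReal.one_lt_top
  · rw [integral_eq_lintegral_of_nonneg_ae (Filter.Eventually.of_forall hnn)
      hm.aestronglyMeasurable, hl, ENNReal.toReal_one]
  · rw [← hK.integral_comp_inner hk he continuous_id', hK.integral_inner_eq_zero hK0]

lemma IsConvexBody.bodyMoment_eq (hK : IsConvexBody K) (hk : k ≠ 0)
    (he : ∀ x, (e x).1 = inner ℝ x θ) {p : ℝ} (hp : 0 ≤ p) :
    bodyMoment p K θ = posMoment p fun t => sliceRoot (e '' K) t ^ k :=
  hK.integral_comp_inner hk he (IsCenteredPowDensity.continuous_posPart_rpow hp)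

lemma IsConvexBody.bodyMoment_neg_eq (hK : IsConvexBody K) (hk : k ≠ 0)
    (he : ∀ x, (e x).1 = inner ℝ x θ) {p : ℝ} (hp : 0 ≤ p) :
    bodyMoment p K (-θ) = posMoment p fun t => sliceRoot (e '' K) (-t) ^ k := by
  have := hK.integral_comp_inner hk he
    ((IsCenteredPowDensity.continuous_posPart_rpow hp).comp continuous_neg)
  simp only [Function.comp_def] at this
  rw [bodyMoment, posMoment,
    ← integral_neg_eq_self fun t : ℝ => max t 0 ^ p * sliceRoot (e '' K) (-t) ^ k]
  simp only [inner_neg_right, neg_neg]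
  exact this

end BodyMoments

/-! ### Slices of a simplex in barycentric coordinates -/

section Simplex

lemma mem_convexHull_range_iff {ι E : Type*} [Fintype ι] [AddCommGroup E] [Module ℝ E]
    {v : ι → E} {x : E} : x ∈ convexHull ℝ (Set.range v) ↔
      ∃ w : ι → ℝ, (∀ i, 0 ≤ w i) ∧ ∑ i, w i = 1 ∧ ∑ i, w i • v i = x := by
  classical
  constructor
  · intro hx
    refine convexHull_min (t := {x | ∃ w : ι → ℝ, (∀ i, 0 ≤ w i) ∧ ∑ i, w i = 1 ∧
      ∑ i, w i • v i = x}) ?_ ?_ hx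
    · rintro _ ⟨i, rfl⟩
      refine ⟨Pi.single i 1, fun j => ?_, by simp, ?_⟩
      · by_cases h : j = i
        · subst h; simp
        · simp [h]
      · simp [Pi.single_apply]
    · rintro _ ⟨w, h0, h1, rfl⟩ _ ⟨w', h0', h1', rfl⟩ a b ha hb hab
      refine ⟨fun i => a * w i + b * w' i, fun i => ?_, ?_, ?_⟩
      · have := h0 i; have := h0' i; positivity
      · rw [Finset.sum_add_distrib, ← Finset.mul_sum, ← Finset.mul_sum, h1, h1']; linarith
      · simp only [add_smul, mul_smul, Finset.sum_add_distrib, ← Finset.smul_sum]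
  · rintro ⟨w, h0, h1, rfl⟩
    exact (convex_convexHull ℝ _).sum_mem (fun i _ => h0 i) h1
      fun i _ => subset_convexHull ℝ _ ⟨i, rfl⟩

variable {n : ℕ} (T : Affine.Simplex ℝ (EuclideanSpace ℝ (Fin n)) n)

lemma isConvexBody_solidSimplex : IsConvexBody (solidSimplex T) where
  convex := convex_convexHull ℝ _
  isCompact := (Set.finite_range _).isCompact_convexHull ℝ
  nonempty_interior := by
    rw [solidSimplex, interior_convexHull_nonempty_iff_affineSpan_eq_top]
    exact T.independent.affineSpan_eq_top_iff_card_eq_finrank_add_one.2 (by simp)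

lemma inner_sum_weights {θ : EuclideanSpace ℝ (Fin n)} {i j : Fin (n + 1)} (hij : i ≠ j) {m : ℝ}
    (hm : ∀ l, l ≠ i → l ≠ j → inner ℝ (T.points l) θ = m) {w : Fin (n + 1) → ℝ}
    (hw : ∑ l, w l = 1) :
    inner ℝ (∑ l, w l • T.points l) θ = m + w i * (inner ℝ (T.points i) θ - m) +
      w j * (inner ℝ (T.points j) θ - m) := by
  have h1 : ∀ l, w l * inner ℝ (T.points l) θ = w l * m +
      ((if l = i then w i * (inner ℝ (T.points i) θ - m) else 0) +
        (if l = j then w j * (inner ℝ (T.points j) θ - m) else 0)) := by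
    intro l
    by_cases hi : l = i
    · subst hi; simp [hij]; ring
    · by_cases hj : l = j
      · subst hj; simp [hi]; ring
      · simp [hi, hj, hm l hi hj]
  rw [sum_inner]
  simp only [inner_smul_left, RCLike.conj_to_real]
  rw [Finset.sum_congr rfl fun l _ => h1 l, Finset.sum_add_distrib, Finset.sum_add_distrib,
    ← Finset.sum_mul, hw]
  simp
  ring

/-- Slices of a simplex by hyperplanes parallel to all but two vertices are homothetic. -/
lemma mem_solidSimplex_slice_iff {θ : EuclideanSpace ℝ (Fin n)} {i j : Fin (n + 1)} (hij : i ≠ j)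
    {m : ℝ} (hm : ∀ l, l ≠ i → l ≠ j → inner ℝ (T.points l) θ = m)
    (hi : inner ℝ (T.points i) θ ≠ m)
    (hopp : (inner ℝ (T.points j) θ - m) / (inner ℝ (T.points i) θ - m) ≤ 0)
    {r : ℝ} (hr0 : 0 < r) (hr1 : r ≤ 1) (x : EuclideanSpace ℝ (Fin n)) :
    (1 - r) • T.points i + r • x ∈ solidSimplex T ∧
      inner ℝ ((1 - r) • T.points i + r • x) θ = (1 - r) * inner ℝ (T.points i) θ + r * m ↔
      x ∈ solidSimplex T ∧ inner ℝ x θ = m := by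
  have hin : inner ℝ ((1 - r) • T.points i + r • x) θ =
      (1 - r) * inner ℝ (T.points i) θ + r * inner ℝ x θ := by
    simp [inner_add_left, inner_smul_left]
  have hc : inner ℝ (T.points i) θ - m ≠ 0 := sub_ne_zero.2 hi
  constructor
  · rintro ⟨h1, h2⟩
    have hxm : inner ℝ x θ = m := by
      rw [hin] at h2
      exact mul_left_cancel₀ hr0.ne' (by linarith)
    refine ⟨?_, hxm⟩
    obtain ⟨w, w0, w1, hw⟩ := mem_convexHull_range_iff.1 h1
    have h3 := inner_sum_weights T hij hm w1
    rw [hw, h2] at h3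
    -- Vertex j lies on the other side of m, or at m, and can only lower the relative height;
    -- reaching height 1 - r therefore needs weight at least 1 - r at vertex i. Removing this weight
    -- and rescaling by r⁻¹ gives weights for x.
    have h4 : 1 - r ≤ w i := by
      have h5 : 1 - r = w i +
          w j * ((inner ℝ (T.points j) θ - m) / (inner ℝ (T.points i) θ - m)) := by
        field_simp
        linarith
      have := mul_nonpos_of_nonneg_of_nonpos (w0 j) hopp
      linarith
    refine mem_convexHull_range_iff.2 ⟨fun l => r⁻¹ * (w l - if l = i then 1 - r else 0),
      fun l => ?_, ?_, ?_⟩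
    · refine mul_nonneg (by positivity) ?_
      by_cases h : l = i
      · subst h; simpa using h4
      · simpa [h] using w0 l
    · rw [← Finset.mul_sum, Finset.sum_sub_distrib, w1]
      simp [hr0.ne']
    · simp only [mul_smul, sub_smul, ← Finset.smul_sum, Finset.sum_sub_distrib, hw, ite_smul,
        zero_smul]
      simp [smul_smul, hr0.ne']
  · rintro ⟨h1, h2⟩
    refine ⟨?_, by rw [hin, h2]⟩
    exact (convex_convexHull ℝ _) (subset_convexHull ℝ _ (Set.mem_range_self i)) h1 (by linarith)
      hr0.le (by ring)

end Simplex

/-! ### The tent shape of simplex marginals -/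

section SimplexSlices

variable {k : ℕ} {T : Affine.Simplex ℝ (EuclideanSpace ℝ (Fin (k + 1))) (k + 1)}
  {θ : EuclideanSpace ℝ (Fin (k + 1))}
  {e : EuclideanSpace ℝ (Fin (k + 1)) ≃L[ℝ] ℝ × (Fin k → ℝ)}
  {i j : Fin (k + 1 + 1)} {m : ℝ}

/-- No other vertex lies beyond m on the side of vertex i, so reaching its height takes full weight
there. This treats the ratio r = 0, where the homothety degenerates. -/
lemma eq_vertex_of_inner_eq (hij : i ≠ j)
    (hm : ∀ l, l ≠ i → l ≠ j → inner ℝ (T.points l) θ = m) (hi : inner ℝ (T.points i) θ ≠ m)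
    (hopp : (inner ℝ (T.points j) θ - m) / (inner ℝ (T.points i) θ - m) ≤ 0)
    {x : EuclideanSpace ℝ (Fin (k + 1))} (hx : x ∈ solidSimplex T)
    (hxi : inner ℝ x θ = inner ℝ (T.points i) θ) : x = T.points i := by
  obtain ⟨w, w0, w1, rfl⟩ := mem_convexHull_range_iff.1 hx
  have hc : inner ℝ (T.points i) θ - m ≠ 0 := sub_ne_zero.2 hi
  rw [inner_sum_weights T hij hm w1] at hxi
  have h5 : 1 = w i + w j * ((inner ℝ (T.points j) θ - m) / (inner ℝ (T.points i) θ - m)) := by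
    field_simp
    linarith
  have h6 := mul_nonpos_of_nonneg_of_nonpos (w0 j) hopp
  rw [Fintype.sum_eq_add_sum_compl i] at w1
  have h7 : ∑ l ∈ {i}ᶜ, w l = 0 :=
    le_antisymm (by linarith) (Finset.sum_nonneg fun l _ => w0 l)
  have h8 : ∀ l ≠ i, w l = 0 := fun l hl =>
    (Finset.sum_eq_zero_iff_of_nonneg fun l _ => w0 l).1 h7 l (by simpa using hl)
  rw [Finset.sum_eq_single i (fun l _ hl => by rw [h8 l hl, zero_smul]) (by simp)]
  rw [show w i = 1 by linarith, one_smul]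

/-- The slice at this height is the image of the slice at m under the homothety with centre vertex i
and ratio r; for r = 0 it is a single point, which is null because k ≠ 0. -/
lemma sliceRoot_solidSimplex (hk : k ≠ 0) (he : ∀ x, (e x).1 = inner ℝ x θ) (hij : i ≠ j)
    (hm : ∀ l, l ≠ i → l ≠ j → inner ℝ (T.points l) θ = m) (hi : inner ℝ (T.points i) θ ≠ m)
    (hopp : (inner ℝ (T.points j) θ - m) / (inner ℝ (T.points i) θ - m) ≤ 0)
    {r : ℝ} (hr0 : 0 ≤ r) (hr1 : r ≤ 1) :
    sliceRoot (e '' solidSimplex T) ((1 - r) * inner ℝ (T.points i) θ + r * m) =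
      r * sliceRoot (e '' solidSimplex T) m := by
  rcases hr0.lt_or_eq with hr | rfl
  · set y := (e (T.points i)).2 with hy
    have hey : e (T.points i) = (inner ℝ (T.points i) θ, y) := Prod.ext (he _) rfl
    have key : ∀ z, ((1 - r) * inner ℝ (T.points i) θ + r * m, (1 - r) • y + r • z) ∈
        e '' solidSimplex T ↔ (m, z) ∈ e '' solidSimplex T := by
      intro z
      have h1 : e ((1 - r) • T.points i + r • e.symm (m, z)) =
          ((1 - r) * inner ℝ (T.points i) θ + r * m, (1 - r) • y + r • z) := by
        rw [map_add, map_smul, map_smul, e.apply_symm_apply, hey]; rfl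
      have h2 : inner ℝ (e.symm (m, z)) θ = m := by rw [← he, e.apply_symm_apply]
      have h3 := mem_solidSimplex_slice_iff T hij hm hi hopp hr hr1 (e.symm (m, z))
      rw [← he ((1 - r) • T.points i + r • e.symm (m, z)), h1, h2] at h3
      simp only [and_true] at h3
      rw [e.image_eq_preimage_symm, Set.mem_preimage, Set.mem_preimage, ← h3, ← h1,
        e.symm_apply_apply]
    refine sliceRoot_homothety hk hr0 y ?_
    ext z
    simp only [Set.mem_preimage, Set.mem_image (AffineMap.homothety y r),
      AffineMap.homothety_apply, vsub_eq_sub, vadd_eq_add]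
    constructor
    · intro hz
      refine ⟨r⁻¹ • (z - (1 - r) • y), ?_, ?_⟩
      · rw [← key, smul_smul, mul_inv_cancel₀ hr.ne']
        simpa using hz
      · rw [smul_sub, smul_smul, mul_inv_cancel₀ hr.ne']
        module
    · rintro ⟨z', hz', rfl⟩
      rw [← key] at hz'
      convert hz' using 2
      module
  · rw [zero_mul (sliceRoot _ _)]
    have : Nonempty (Fin k) := Fin.pos_iff_nonempty.1 (Nat.pos_of_ne_zero hk)
    refine sliceRoot_eq_zero hk (Set.Subsingleton.measure_zero ?_ _)
    have huniq : ∀ z, ((1 - 0) * inner ℝ (T.points i) θ + 0 * m, z) ∈ e '' solidSimplex T →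
        z = (e (T.points i)).2 := by
      rintro z ⟨x, hx, hxz⟩
      have h1 := eq_vertex_of_inner_eq hij hm hi hopp hx (by rw [← he, hxz]; simp)
      rw [← h1, hxz]
    intro z hz z' hz'
    rw [huniq z hz, huniq z' hz']

/-- The degenerate side of a tent, where the root may jump at the end m. By `hside`, m is not
strictly between two points of s, so a convex combination equal to m puts no weight on points other
than m. -/
lemma convexOn_of_eq_zero_of_ne {γ : ℝ → ℝ} {s : Set ℝ} (hs : Convex ℝ s)
    (hside : ∀ x ∈ s, ∀ y ∈ s, 0 ≤ (x - m) * (y - m)) (h0 : ∀ t, 0 ≤ γ t)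
    (h : ∀ t ∈ s, t ≠ m → γ t = 0) : ConvexOn ℝ s γ := by
  refine ⟨hs, fun x hx y hy a b ha hb hab => ?_⟩
  simp only [smul_eq_mul]
  by_cases hm : a * x + b * y = m
  · have h1 : a * (x - m) + b * (y - m) = 0 := by linear_combination hm - m * hab
    have hxy := hside x hx y hy
    have h2 : a = 0 ∨ x = m := by
      have : a * (x - m) ^ 2 = 0 := by
        refine le_antisymm ?_ (by positivity)
        have := mul_nonneg hb hxy
        have : a * (x - m) ^ 2 = -(b * ((x - m) * (y - m))) := by
          linear_combination (x - m) * h1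
        linarith
      simpa [sub_eq_zero] using this
    have h3 : b = 0 ∨ y = m := by
      have : b * (y - m) ^ 2 = 0 := by
        refine le_antisymm ?_ (by positivity)
        have := mul_nonneg ha hxy
        have : b * (y - m) ^ 2 = -(a * ((x - m) * (y - m))) := by
          linear_combination (y - m) * h1
        linarith
      simpa [sub_eq_zero] using this
    have h4 : a * γ x = a * γ m := by rcases h2 with rfl | rfl <;> simp
    have h5 : b * γ y = b * γ m := by rcases h3 with rfl | rfl <;> simp
    rw [hm, h4, h5, ← add_mul, hab, one_mul]
  · have hmem : a * x + b * y ∈ s := hs hx hy ha hb hab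
    rw [h _ hmem hm]
    have := h0 x
    have := h0 y
    positivity

/-- On s the function equals the maximum of 0 and the affine function that vanishes at the apex
height c and agrees with γ at m. -/
lemma convexOn_of_affine {γ : ℝ → ℝ} {s : Set ℝ} {c : ℝ} (hs : Convex ℝ s) (hc : c ≠ m)
    (h0 : ∀ t, 0 ≤ γ t) (hs1 : ∀ t ∈ s, (t - c) / (m - c) ≤ 1)
    (hin : ∀ r, 0 ≤ r → r ≤ 1 → γ ((1 - r) * c + r * m) = r * γ m)
    (hout : ∀ t ∈ s, (t - c) / (m - c) < 0 → γ t = 0) : ConvexOn ℝ s γ := by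
  have hmc : m - c ≠ 0 := sub_ne_zero.2 hc.symm
  have hf : ConvexOn ℝ s fun t => max ((t - c) / (m - c) * γ m) 0 := by
    refine ConvexOn.sup ⟨hs, fun x _ y _ a b _ _ hab => le_of_eq ?_⟩ (convexOn_const 0 hs)
    simp only [smul_eq_mul]
    rw [div_eq_mul_inv, div_eq_mul_inv, div_eq_mul_inv]
    linear_combination c * (m - c)⁻¹ * γ m * hab
  refine hf.congr fun t ht => ?_
  rcases lt_or_ge ((t - c) / (m - c)) 0 with h | h
  · rw [hout t ht h]
    exact max_eq_right (mul_nonpos_of_nonpos_of_nonneg h.le (h0 m))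
  · have e : (1 - (t - c) / (m - c)) * c + (t - c) / (m - c) * m = t := by
      field_simp; ring
    have := hin _ h (hs1 t ht)
    rw [e] at this
    rw [this]
    exact max_eq_left (mul_nonneg h (h0 m))

/-- The root of the density of a simplex marginal that is constant on all but two vertices is
affine on each side of the common value. -/
lemma convexOn_sliceRoot_solidSimplex (hk : k ≠ 0) (he : ∀ x, (e x).1 = inner ℝ x θ) (hij : i ≠ j)
    (hm : ∀ l, l ≠ i → l ≠ j → inner ℝ (T.points l) θ = m) (hi : inner ℝ (T.points i) θ ≤ m)
    (hj : m ≤ inner ℝ (T.points j) θ) :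
    ConvexOn ℝ (Set.Iic m) (sliceRoot (e '' solidSimplex T)) ∧
    ConvexOn ℝ (Set.Ici m) (sliceRoot (e '' solidSimplex T)) ∧
      (inner ℝ (T.points i) θ = m → ∀ t < m, sliceRoot (e '' solidSimplex T) t = 0) := by
  set γ := sliceRoot (e '' solidSimplex T) with hγ
  set a := inner ℝ (T.points i) θ with ha
  set b := inner ℝ (T.points j) θ with hb
  have hγm : 0 ≤ γ m := sliceRoot_nonneg m
  have hbd : ∀ x ∈ solidSimplex T, a ≤ inner ℝ x θ ∧ inner ℝ x θ ≤ b := by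
    intro x hx
    obtain ⟨w, w0, w1, rfl⟩ := mem_convexHull_range_iff.1 hx
    rw [inner_sum_weights T hij hm w1]
    have hw : ∀ l, w l ≤ 1 := fun l =>
      w1 ▸ Finset.single_le_sum (fun l _ => w0 l) (Finset.mem_univ l)
    have h1 := mul_nonneg (w0 j) (sub_nonneg.2 hj)
    have h2 := mul_nonneg (w0 i) (sub_nonneg.2 hi)
    have h3 := mul_nonneg (sub_nonneg.2 (hw i)) (sub_nonneg.2 hi)
    have h4 := mul_nonneg (sub_nonneg.2 (hw j)) (sub_nonneg.2 hj)
    constructor <;> nlinarith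
  have hout : ∀ t, t < a ∨ b < t → γ t = 0 := by
    intro t ht
    refine sliceRoot_eq_zero hk ?_
    have : Prod.mk t ⁻¹' (e '' solidSimplex T) = ∅ := by
      ext y
      simp only [Set.mem_preimage, Set.mem_empty_iff_false, iff_false]
      rintro ⟨x, hx, hxy⟩
      have h1 := hbd x hx
      rw [← he x, hxy] at h1
      simp only at h1
      rcases ht with h | h <;> linarith
    simp [this]
  refine ⟨?_, ?_, ?_⟩
  · rcases hi.lt_or_eq with hlt | heq
    · have h0 : 0 < m - a := by linarith
      refine convexOn_of_affine (convex_Iic m) hlt.ne sliceRoot_nonneg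
        (fun t ht => (div_le_one h0).2 (by linarith [Set.mem_Iic.1 ht])) (fun r hr0 hr1 => ?_)
        (fun t _ h => hout t (Or.inl ?_))
      · exact sliceRoot_solidSimplex hk he hij hm hlt.ne
          (div_nonpos_of_nonneg_of_nonpos (by linarith) (by linarith)) hr0 hr1
      · by_contra! h'
        exact absurd (div_nonneg (sub_nonneg.2 h') h0.le) (not_le.2 h)
    · refine convexOn_of_eq_zero_of_ne (m := m) (convex_Iic m) (fun x hx y hy => ?_)
        sliceRoot_nonneg (fun t ht h => hout t (Or.inl (heq ▸ lt_of_le_of_ne ht h)))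
      exact mul_nonneg_of_nonpos_of_nonpos (sub_nonpos.2 hx) (sub_nonpos.2 hy)
  · rcases hj.lt_or_eq with hlt | heq
    · have h0 : m - b < 0 := by linarith
      refine convexOn_of_affine (convex_Ici m) hlt.ne' sliceRoot_nonneg
        (fun t ht => (div_le_one_of_neg h0).2 (by linarith [Set.mem_Ici.1 ht]))
        (fun r hr0 hr1 => ?_) (fun t _ h => hout t (Or.inr ?_))
      · exact sliceRoot_solidSimplex hk he hij.symm (fun l h1 h2 => hm l h2 h1) hlt.ne'
          (div_nonpos_of_nonpos_of_nonneg (by linarith) (by linarith)) hr0 hr1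
      · by_contra! h'
        exact absurd (div_nonneg_of_nonpos (sub_nonpos.2 h') h0.le) (not_le.2 h)
    · refine convexOn_of_eq_zero_of_ne (m := m) (convex_Ici m) (fun x hx y hy => ?_)
        sliceRoot_nonneg (fun t ht h => hout t (Or.inr (heq ▸ lt_of_le_of_ne ht h.symm)))
      exact mul_nonneg (sub_nonneg.2 hx) (sub_nonneg.2 hy)
  · intro h t ht
    exact hout t (Or.inl (h ▸ ht))

end SimplexSlices

/-! ### Comparison of body marginals with simplex marginals -/

section Comparison

lemma withDensity_eq_of_integral_Ioi_eq {k : ℕ} {R : ℝ} {φ γ : ℝ → ℝ}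
    (hφ : IsCenteredPowDensity k R φ) (hγ : IsCenteredPowDensity k R γ)
    (h : ∀ z, ∫ t in Set.Ioi z, φ t ^ k = ∫ t in Set.Ioi z, γ t ^ k) :
    volume.withDensity (fun t => ENNReal.ofReal (φ t ^ k)) =
      volume.withDensity fun t => ENNReal.ofReal (γ t ^ k) := by
  have hfin : ∀ {ψ : ℝ → ℝ}, IsCenteredPowDensity k R ψ →
      IsFiniteMeasure (volume.withDensity fun t => ENNReal.ofReal (ψ t ^ k)) := fun hψ =>
    isFiniteMeasure_withDensity_ofReal hψ.integrable.2
  have := hfin hφ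
  have := hfin hγ
  have hcdf : ∀ {ψ : ℝ → ℝ}, IsCenteredPowDensity k R ψ → ∀ a,
      volume.withDensity (fun t => ENNReal.ofReal (ψ t ^ k)) (Set.Iic a) =
        ENNReal.ofReal (1 - ∫ t in Set.Ioi a, ψ t ^ k) := by
    intro ψ hψ a
    rw [withDensity_apply _ measurableSet_Iic, ← ofReal_integral_eq_lintegral_ofReal
      hψ.integrable.integrableOn (Filter.Eventually.of_forall fun t => pow_nonneg (hψ.nonneg t) k)]
    have h3 := integral_add_compl (measurableSet_Ioi (a := a)) hψ.integrable
    rw [Set.compl_Ioi, hψ.integral_eq] at h3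
    rw [← h3]; ring_nf
  refine Measure.ext_of_Iic _ _ fun a => ?_
  rw [hcdf hφ, hcdf hγ, h]

/-- The functional `w` takes a common value `m` on all vertices of `T` but `i` and `j`, at most
`m` on the vertex `i`, and at least `m` on the vertex `j`. -/
structure IsTentDirection {n : ℕ} (T : Affine.Simplex ℝ (EuclideanSpace ℝ (Fin n)) n)
    (i j : Fin (n + 1)) (w : EuclideanSpace ℝ (Fin n)) (m : ℝ) : Prop where
  ne : i ≠ j
  eq : ∀ l, l ≠ i → l ≠ j → inner ℝ (T.points l) w = m
  le : inner ℝ (T.points i) w ≤ m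
  ge : m ≤ inner ℝ (T.points j) w

lemma IsTentDirection.smul {n : ℕ} {T : Affine.Simplex ℝ (EuclideanSpace ℝ (Fin n)) n}
    {i j : Fin (n + 1)} {w : EuclideanSpace ℝ (Fin n)} {m : ℝ} (h : IsTentDirection T i j w m)
    {c : ℝ} (hc : 0 ≤ c) : IsTentDirection T i j (c • w) (c * m) where
  ne := h.ne
  eq l hi hj := by rw [inner_smul_right, h.eq l hi hj]
  le := by rw [inner_smul_right]; exact mul_le_mul_of_nonneg_left h.le hc
  ge := by rw [inner_smul_right]; exact mul_le_mul_of_nonneg_left h.ge hc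

lemma bodyMoment_smul {n : ℕ} {K : Set (EuclideanSpace ℝ (Fin n))} {θ : EuclideanSpace ℝ (Fin n)}
    {c p : ℝ} (hc : 0 ≤ c) : bodyMoment p K (c • θ) = c ^ p * bodyMoment p K θ := by
  rw [bodyMoment, bodyMoment, ← integral_const_mul]
  congr 1; ext x
  rw [inner_smul_right, ← Real.mul_rpow hc (le_max_right _ _), mul_max_of_nonneg _ _ hc, mul_zero]

variable {k : ℕ} {K : Set (EuclideanSpace ℝ (Fin (k + 1)))} {θ w : EuclideanSpace ℝ (Fin (k + 1))}
  {T : Affine.Simplex ℝ (EuclideanSpace ℝ (Fin (k + 1))) (k + 1)} {i j : Fin (k + 1 + 1)} {m : ℝ}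
  {p q : ℝ}

lemma IsConvexBody.bodyMoment_pos (hK : IsConvexBody K) (hK0 : IsCentered K) (hk : k ≠ 0)
    (hθ : θ ≠ 0) (hp : 0 < p) : 0 < bodyMoment p K θ := by
  obtain ⟨e, he⟩ := exists_continuousLinearEquiv_fst_eq_inner hθ
  obtain ⟨R, hR⟩ := hK.exists_isCenteredPowDensity hK0 hk he
  rw [hK.bodyMoment_eq hk he hp.le]
  exact hR.posMoment_pos hp

/-- A convex body marginal with the same `p`-moments on the two half-lines as a tent marginal of a
simplex has smaller `q`-moments, and equality forces the laws to agree. -/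
theorem IsConvexBody.bodyMoment_le (hK : IsConvexBody K) (hK0 : IsCentered K)
    (hT0 : IsCentered (solidSimplex T)) (hk : k ≠ 0) (hθ : θ ≠ 0) (hw : w ≠ 0)
    (ht : IsTentDirection T i j w m) (hp : 1 < p) (hpq : p < q)
    (hpos : bodyMoment p K θ = bodyMoment p (solidSimplex T) w)
    (hneg : bodyMoment p K (-θ) = bodyMoment p (solidSimplex T) (-w)) :
    bodyMoment q K θ ≤ bodyMoment q (solidSimplex T) w ∧
    bodyMoment q K (-θ) ≤ bodyMoment q (solidSimplex T) (-w) ∧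
      (bodyMoment q K θ = bodyMoment q (solidSimplex T) w →
        bodyMoment q K (-θ) = bodyMoment q (solidSimplex T) (-w) →
        marginalLaw K θ = marginalLaw (solidSimplex T) w) := by
  have hp0 : 0 ≤ p := by linarith
  have hq0 : 0 ≤ q := by linarith
  have hT := isConvexBody_solidSimplex T
  obtain ⟨e, he⟩ := exists_continuousLinearEquiv_fst_eq_inner hθ
  obtain ⟨e', he'⟩ := exists_continuousLinearEquiv_fst_eq_inner hw
  obtain ⟨R, hR⟩ := hK.exists_isCenteredPowDensity hK0 hk he
  obtain ⟨R', hR'⟩ := hT.exists_isCenteredPowDensity hT0 hk he'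
  have hc := concaveOnPos_sliceRoot hk (hK.isCompact.image e.continuous)
    (hK.convex.linear_image e.toLinearEquiv.toLinearMap)
  obtain ⟨hl, hr, -⟩ := convexOn_sliceRoot_solidSimplex hk he' ht.ne ht.eq ht.le ht.ge
  rw [hK.bodyMoment_eq hk he hp0, hT.bodyMoment_eq hk he' hp0] at hpos
  rw [hK.bodyMoment_neg_eq hk he hp0, hT.bodyMoment_neg_eq hk he' hp0] at hneg
  rw [hK.bodyMoment_eq hk he hq0, hT.bodyMoment_eq hk he' hq0, hK.bodyMoment_neg_eq hk he hq0,
    hT.bodyMoment_neg_eq hk he' hq0, hK.marginalLaw_eq_withDensity hk he,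
    hT.marginalLaw_eq_withDensity hk he']
  have hφ := hR.mono (le_max_left R R')
  have hγ := hR'.mono (le_max_right R R')
  obtain ⟨h1, h2, h3⟩ := hφ.posMoment_le_and_eq hγ hc hl hr hp hpq hpos.symm hneg.symm
  exact ⟨h1, h2, fun e1 e2 => withDensity_eq_of_integral_Ioi_eq hφ hγ (h3 e1 e2)⟩

/-- Among all marginals of centered convex bodies, the facet normals of a simplex are extremal
for the ratio between the `p`-moments on the two half-lines. -/
theorem IsConvexBody.bodyMoment_ratio_le (hK : IsConvexBody K) (hK0 : IsCentered K)
    (hT0 : IsCentered (solidSimplex T)) (hk : k ≠ 0) (hθ : θ ≠ 0) (hw : w ≠ 0)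
    (ht : IsTentDirection T i j w m) (hi : inner ℝ (T.points i) w = m) (hp : 1 < p) :
    bodyMoment p (solidSimplex T) (-w) * bodyMoment p K θ ≤
      bodyMoment p K (-θ) * bodyMoment p (solidSimplex T) w := by
  have hp0 : 0 < p := by linarith
  have hT := isConvexBody_solidSimplex T
  have hKpos := hK.bodyMoment_pos hK0 hk hθ hp0
  have hTpos := hT.bodyMoment_pos hT0 hk hw hp0
  -- Moments are homogeneous of degree p, so this scaling of w matches the positive p-moments.
  obtain ⟨c, hc0, hcp⟩ : ∃ c : ℝ, 0 < c ∧
      c ^ p = bodyMoment p K θ / bodyMoment p (solidSimplex T) w := by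
    refine ⟨(bodyMoment p K θ / bodyMoment p (solidSimplex T) w) ^ p⁻¹, by positivity, ?_⟩
    rw [← Real.rpow_mul (by positivity), inv_mul_cancel₀ hp0.ne', Real.rpow_one]
  have hcw : c • w ≠ 0 := smul_ne_zero hc0.ne' hw
  have ht' := ht.smul hc0.le
  obtain ⟨e, he⟩ := exists_continuousLinearEquiv_fst_eq_inner hθ
  obtain ⟨e', he'⟩ := exists_continuousLinearEquiv_fst_eq_inner hcw
  obtain ⟨R, hR⟩ := hK.exists_isCenteredPowDensity hK0 hk he
  obtain ⟨R', hR'⟩ := hT.exists_isCenteredPowDensity hT0 hk he'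
  have hc := concaveOnPos_sliceRoot hk (hK.isCompact.image e.continuous)
    (hK.convex.linear_image e.toLinearEquiv.toLinearMap)
  obtain ⟨-, hr, hl⟩ := convexOn_sliceRoot_solidSimplex hk he' ht'.ne ht'.eq ht'.le ht'.ge
  have hpos : bodyMoment p (solidSimplex T) (c • w) = bodyMoment p K θ := by
    rw [bodyMoment_smul hc0.le, hcp, div_mul_cancel₀ _ hTpos.ne']
  rw [hK.bodyMoment_eq hk he hp0.le, hT.bodyMoment_eq hk he' hp0.le] at hpos
  have key := (hR.mono (le_max_left R R')).posMoment_neg_le (hR'.mono (le_max_right R R')) hc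
    (hl (by rw [inner_smul_right, hi])) hr hp hpos
  rw [← hK.bodyMoment_neg_eq hk he hp0.le, ← hT.bodyMoment_neg_eq hk he' hp0.le, ← smul_neg,
    bodyMoment_smul hc0.le, hcp, div_mul_eq_mul_div, div_le_iff₀ hTpos] at key
  linarith

end Comparison

/-! ### Continuity of moments in the direction -/

section Continuity

variable {n : ℕ} {K : Set (EuclideanSpace ℝ (Fin n))}

lemma IsConvexBody.continuous_integral_inner (hK : IsConvexBody K) {h : ℝ → ℝ}
    (hh : Continuous h) :
    Continuous fun θ : EuclideanSpace ℝ (Fin n) => ∫ x, h (inner ℝ x θ) ∂(uniformLaw K) := by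
  have h1 : Continuous fun θ : EuclideanSpace ℝ (Fin n) => ∫ x in K, h (inner ℝ x θ) :=
    continuous_parametric_integral_of_continuous
      (f := fun (θ x : EuclideanSpace ℝ (Fin n)) => h (inner ℝ x θ))
      (hh.comp (continuous_snd.inner continuous_fst)) hK.isCompact
  simp only [uniformLaw, ProbabilityTheory.cond, integral_smul_measure]
  exact h1.const_smul ((volume K)⁻¹).toReal

lemma IsConvexBody.continuous_bodyMoment (hK : IsConvexBody K) {p : ℝ} (hp : 0 ≤ p) :
    Continuous (bodyMoment p K) :=
  hK.continuous_integral_inner (IsCenteredPowDensity.continuous_posPart_rpow hp)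

end Continuity

/-! ### Matching both half-line p-moments -/

section Matching

variable {n : ℕ} {K : Set (EuclideanSpace ℝ (Fin n))} {θ : EuclideanSpace ℝ (Fin n)}

lemma marginalLaw_smul (c : ℝ) :
    marginalLaw K (c • θ) = (marginalLaw K θ).map fun t => c * t := by
  rw [marginalLaw, marginalLaw, Measure.map_map (by fun_prop) (by fun_prop)]
  congr 1; ext x
  simp [inner_smul_right]

lemma bodyMoment_eq_integral_marginalLaw {p : ℝ} (hp : 0 ≤ p) :
    bodyMoment p K θ = ∫ t, max t 0 ^ p ∂(marginalLaw K θ) := by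
  rw [marginalLaw, integral_map (by fun_prop)
    (IsCenteredPowDensity.continuous_posPart_rpow hp).aestronglyMeasurable, bodyMoment]

lemma bodyMoment_neg_eq_integral_marginalLaw {p : ℝ} (hp : 0 ≤ p) :
    bodyMoment p K (-θ) = ∫ t, max (-t) 0 ^ p ∂(marginalLaw K θ) := by
  rw [marginalLaw, integral_map (f := fun t : ℝ => max (-t) 0 ^ p) (by fun_prop)
    ((IsCenteredPowDensity.continuous_posPart_rpow hp).comp continuous_neg).aestronglyMeasurable,
    bodyMoment]
  simp

variable {T : Affine.Simplex ℝ (EuclideanSpace ℝ (Fin n)) n} {i j : Fin (n + 1)}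
  {u v : EuclideanSpace ℝ (Fin n)}

lemma IsOuterUnitNormal.ne_zero (hu : IsOuterUnitNormal T i u) : u ≠ 0 := by
  rintro rfl
  simpa using hu.1

/-- Each normal is constant on all vertices but its own, where it is smaller. The opposite signs of
the coefficients put vertices i and j on opposite sides of the common value. -/
lemma IsOuterUnitNormal.exists_isTentDirection (hij : i ≠ j) (hu : IsOuterUnitNormal T i u)
    (hv : IsOuterUnitNormal T j v) {s : ℝ} (hs : s ∈ Set.Icc (0 : ℝ) 1) :
    ∃ m, IsTentDirection T i j (s • u - (1 - s) • v) m := by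
  obtain ⟨-, a, ha, hai⟩ := hu
  obtain ⟨-, b, hb, hbj⟩ := hv
  have e : ∀ l, inner ℝ (T.points l) (s • u - (1 - s) • v) =
      s * inner ℝ (T.points l) u - (1 - s) * inner ℝ (T.points l) v := fun l => by
    rw [inner_sub_right, inner_smul_right, inner_smul_right]
  refine ⟨s * a - (1 - s) * b, hij, fun l h1 h2 => ?_, ?_, ?_⟩
  · rw [e, ha l h1, hb l h2]
  · rw [e, hb i hij]
    have := mul_le_mul_of_nonneg_left hai.le hs.1
    linarith
  · rw [e, ha j hij.symm]
    have := mul_le_mul_of_nonneg_left hbj.le (sub_nonneg.2 hs.2)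
    linarith

lemma IsOuterUnitNormal.isTentDirection_neg (hij : i ≠ j) (hv : IsOuterUnitNormal T j v) :
    IsTentDirection T i j (-v) (inner ℝ (T.points i) (-v)) := by
  obtain ⟨-, b, hb, hbj⟩ := hv
  refine ⟨hij, fun l h1 h2 => ?_, le_rfl, ?_⟩
  · rw [inner_neg_right, inner_neg_right, hb l h2, hb i hij]
  · rw [inner_neg_right, inner_neg_right, hb i hij]
    linarith

/-- The combination differs between vertex i and a third vertex by s times a positive number; if it
were zero, then s = 0, leaving -v ≠ 0. -/
lemma IsOuterUnitNormal.sub_ne_zero (hn : 2 ≤ n) (hij : i ≠ j) (hu : IsOuterUnitNormal T i u)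
    (hv : IsOuterUnitNormal T j v) (s : ℝ) : s • u - (1 - s) • v ≠ 0 := by
  intro h
  obtain ⟨l, hl⟩ : ∃ l : Fin (n + 1), l ∉ ({i, j} : Finset (Fin (n + 1))) := by
    by_contra! hall
    have h1 : (Finset.univ : Finset (Fin (n + 1))).card ≤ ({i, j} : Finset (Fin (n + 1))).card :=
      Finset.card_le_card fun l _ => hall l
    have h2 : ({i, j} : Finset (Fin (n + 1))).card ≤ 2 := Finset.card_le_two
    simp at h1
    omega
  simp only [Finset.mem_insert, Finset.mem_singleton, not_or] at hl
  have hv0 := hv.ne_zero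
  obtain ⟨-, a, ha, hai⟩ := hu
  obtain ⟨-, b, hb, hbj⟩ := hv
  have e : ∀ l, inner ℝ (T.points l) (s • u - (1 - s) • v) =
      s * inner ℝ (T.points l) u - (1 - s) * inner ℝ (T.points l) v := fun l => by
    rw [inner_sub_right, inner_smul_right, inner_smul_right]
  have h1 := e i
  have h2 := e l
  rw [h, inner_zero_right, hb i hij] at h1
  rw [h, inner_zero_right, hb l hl.2, ha l hl.1] at h2
  have h3 : s * (a - inner ℝ (T.points i) u) = 0 := by linarith
  have h4 : s = 0 := by
    rcases mul_eq_zero.1 h3 with h | h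
    · exact h
    · linarith
  rw [h4] at h
  simp [hv0] at h

/-- The tent marginals of the simplex match the `p`-moments of every centered convex body. -/
theorem exists_matching_direction {k : ℕ} (hk : k ≠ 0)
    {K : Set (EuclideanSpace ℝ (Fin (k + 1)))} {θ : EuclideanSpace ℝ (Fin (k + 1))}
    {T : Affine.Simplex ℝ (EuclideanSpace ℝ (Fin (k + 1))) (k + 1)} {i j : Fin (k + 1 + 1)}
    {u v : EuclideanSpace ℝ (Fin (k + 1))} (hK : IsConvexBody K) (hK0 : IsCentered K)
    (hT0 : IsCentered (solidSimplex T)) (hθ : θ ≠ 0) (hij : i ≠ j)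
    (hu : IsOuterUnitNormal T i u) (hv : IsOuterUnitNormal T j v) {p : ℝ} (hp : 1 < p) :
    ∃ s ∈ Set.Icc (0 : ℝ) 1, ∃ c : ℝ, 0 < c ∧
      bodyMoment p K θ = bodyMoment p (solidSimplex T) (c • (s • u - (1 - s) • v)) ∧
      bodyMoment p K (-θ) = bodyMoment p (solidSimplex T) (-(c • (s • u - (1 - s) • v))) := by
  have hp0 : 0 < p := by linarith
  have hT := isConvexBody_solidSimplex T
  have hne := fun s => hu.sub_ne_zero (by omega) hij hv s
  set W : ℝ → EuclideanSpace ℝ (Fin (k + 1)) := fun s => s • u - (1 - s) • v with hW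
  have hWc : Continuous W := by fun_prop
  have hc := hT.continuous_bodyMoment hp0.le
  -- F vanishes exactly when the cross products of the half-moments agree, so that one scaling can
  -- match both. The endpoint directions -v and u have extremal half-moment ratios, which gives F
  -- opposite signs there.
  set F : ℝ → ℝ := fun s => bodyMoment p (solidSimplex T) (W s) * bodyMoment p K (-θ) -
    bodyMoment p (solidSimplex T) (-W s) * bodyMoment p K θ with hF
  have hFc : Continuous F := by
    refine ((hc.comp hWc).mul continuous_const).sub ((hc.comp hWc.neg).mul continuous_const)
  have h0 : 0 ≤ F 0 := by
    have := hK.bodyMoment_ratio_le hK0 hT0 hk hθ (neg_ne_zero.2 hv.ne_zero)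
      (hv.isTentDirection_neg hij) rfl hp
    simp only [hF, hW, zero_smul, sub_zero, one_smul, zero_sub]
    linarith
  have h1 : F 1 ≤ 0 := by
    have := hK.bodyMoment_ratio_le hK0 hT0 hk (neg_ne_zero.2 hθ) (neg_ne_zero.2 hu.ne_zero)
      (hu.isTentDirection_neg hij.symm) rfl hp
    simp only [hF, hW, one_smul, sub_self, zero_smul, sub_zero]
    rw [neg_neg, neg_neg] at this
    linarith
  obtain ⟨s, hs, hs0⟩ := intermediate_value_Icc' zero_le_one hFc.continuousOn ⟨h1, h0⟩
  have hTpos := hT.bodyMoment_pos hT0 hk (hne s) hp0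
  have hKpos := hK.bodyMoment_pos hK0 hk hθ hp0
  change 0 < bodyMoment p (solidSimplex T) (W s) at hTpos
  -- The scale is read off from the positive half-moments; F s = 0 then gives the negative ones.
  refine ⟨s, hs, (bodyMoment p K θ / bodyMoment p (solidSimplex T) (W s)) ^ p⁻¹, by positivity,
    ?_, ?_⟩
  · rw [bodyMoment_smul (by positivity), ← Real.rpow_mul (by positivity),
      inv_mul_cancel₀ hp0.ne', Real.rpow_one, div_mul_cancel₀ _ hTpos.ne']
  · rw [← smul_neg, bodyMoment_smul (by positivity), ← Real.rpow_mul (by positivity),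
      inv_mul_cancel₀ hp0.ne', Real.rpow_one, div_mul_eq_mul_div, eq_div_iff hTpos.ne']
    simp only [hF] at hs0
    linarith

end Matching

/-! ### Dimension one -/

section DimensionOne

lemma map_mul_cond_Icc {c r : ℝ} (hc : 0 < c) :
    (cond volume (Set.Icc (-r) r)).map (fun t => c * t) =
      cond volume (Set.Icc (-(c * r)) (c * r)) := by
  have := map_cond_continuousLinearEquiv
    (ContinuousLinearEquiv.unitsEquivAut ℝ (Units.mk0 c hc.ne')) (Set.Icc (-r) r)
  have e : ⇑(ContinuousLinearEquiv.unitsEquivAut ℝ (Units.mk0 c hc.ne')) = fun t => c * t := by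
    ext t; simp [mul_comm]
  rw [e, Set.image_mul_left_Icc' hc] at this
  rw [this]; simp

/-- The image is a compact interval [a, b], and mean zero gives b² = a², hence a = -b. Here k = 0
and the k-th root of the density is unavailable. -/
lemma IsConvexBody.exists_marginalLaw_eq_of_dim_one {K : Set (EuclideanSpace ℝ (Fin 1))}
    (hK : IsConvexBody K) (hK0 : IsCentered K) {θ : EuclideanSpace ℝ (Fin 1)} (hθ : θ ≠ 0) :
    ∃ r : ℝ, 0 < r ∧ marginalLaw K θ = cond volume (Set.Icc (-r) r) := by
  obtain ⟨e, he⟩ := exists_continuousLinearEquiv_fst_eq_inner (k := 0) hθ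
  let e' : EuclideanSpace ℝ (Fin 1) ≃L[ℝ] ℝ :=
    e.trans (LinearEquiv.prodUnique (R := ℝ) (M := ℝ) (M₂ := Fin 0 → ℝ)).toContinuousLinearEquiv
  have he' : ∀ x, e' x = inner ℝ x θ := fun x => he x
  have hlaw : marginalLaw K θ = cond volume (e' '' K) := by
    rw [← map_cond_continuousLinearEquiv e' K, marginalLaw, uniformLaw]
    congr 1; ext x; exact (he' x).symm
  have hinter : (interior (e' '' K)).Nonempty := by
    have h := (hK.nonempty_interior).image e'.toHomeomorph
    rw [e'.toHomeomorph.image_interior] at h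
    exact h
  have hconv : Convex ℝ (e' '' K) := hK.convex.linear_image e'.toLinearEquiv.toLinearMap
  have hIcc := eq_Icc_of_connected_compact ⟨hinter.mono interior_subset, hconv.isPreconnected⟩
    (hK.isCompact.image e'.continuous)
  set a := sInf (e' '' K)
  set b := sSup (e' '' K)
  rw [hIcc] at hlaw hinter
  have hab : a < b := by
    rw [interior_Icc] at hinter
    exact Set.nonempty_Ioo.1 hinter
  have hmean : ∫ t, t ∂(marginalLaw K θ) = 0 := by
    rw [marginalLaw, integral_map (by fun_prop) (by fun_prop), hK.integral_inner_eq_zero hK0]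
  rw [hlaw, ProbabilityTheory.cond, integral_smul_measure, integral_Icc_eq_integral_Ioc,
    ← intervalIntegral.integral_of_le hab.le, integral_id] at hmean
  have h1 : (b ^ 2 - a ^ 2) / 2 = 0 := by
    rcases smul_eq_zero.1 hmean with h | h
    · exfalso
      simp [ENNReal.toReal_eq_zero_iff] at h
      linarith
    · exact h
  have h2 : (b - a) * (b + a) = 0 := by linear_combination 2 * h1
  have h3 : a = -b := by
    rcases mul_eq_zero.1 h2 with h | h <;> linarith
  refine ⟨b, by linarith, ?_⟩
  rw [hlaw, h3]

end DimensionOne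

/-! ### Domination by a tent marginal -/

section Main

variable {n : ℕ} {K : Set (EuclideanSpace ℝ (Fin n))}

/-- Every marginal of a centered convex body is dominated by a rescaled tent marginal of a
centered simplex. -/
theorem exists_dominating_marginal (hn : 1 ≤ n) {p q : ℝ} (hp : 1 < p) (hpq : p < q)
    (hK : IsConvexBody K) (hK0 : IsCentered K)
    {T : Affine.Simplex ℝ (EuclideanSpace ℝ (Fin n)) n} (hT0 : IsCentered (solidSimplex T))
    {i j : Fin (n + 1)} {u v : EuclideanSpace ℝ (Fin n)} (hij : i ≠ j)
    (hu : IsOuterUnitNormal T i u) (hv : IsOuterUnitNormal T j v)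
    {θ : EuclideanSpace ℝ (Fin n)} (hθ : θ ≠ 0) :
    ∃ s ∈ Set.Icc (0 : ℝ) 1, ∃ c : ℝ, 0 < c ∧ interpDirection u v s ∈ Metric.sphere 0 1 ∧
      bodyMoment p K θ = bodyMoment p (solidSimplex T) (c • interpDirection u v s) ∧
      bodyMoment p K (-θ) = bodyMoment p (solidSimplex T) (-(c • interpDirection u v s)) ∧
      bodyMoment q K θ ≤ bodyMoment q (solidSimplex T) (c • interpDirection u v s) ∧
      bodyMoment q K (-θ) ≤ bodyMoment q (solidSimplex T) (-(c • interpDirection u v s)) ∧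
      (bodyMoment q K θ = bodyMoment q (solidSimplex T) (c • interpDirection u v s) →
        bodyMoment q K (-θ) = bodyMoment q (solidSimplex T) (-(c • interpDirection u v s)) →
        marginalLaw K θ = marginalLaw (solidSimplex T) (c • interpDirection u v s)) := by
  have hsphere : ∀ s, s • u - (1 - s) • v ≠ 0 →
      interpDirection u v s ∈ Metric.sphere (0 : EuclideanSpace ℝ (Fin n)) 1 := by
    intro s hs
    rw [mem_sphere_zero_iff_norm, interpDirection, norm_smul, norm_inv, norm_norm,
      inv_mul_cancel₀ (norm_ne_zero_iff.2 hs)]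
  obtain ⟨k, rfl⟩ : ∃ k, n = k + 1 := ⟨n - 1, by omega⟩
  rcases eq_or_ne k 0 with rfl | hk
  -- For n = 1 all marginals are uniform on symmetric intervals, so s = 0 serves and a scaling by r
  -- / r' makes the laws equal.
  · have hs0 : (0 : ℝ) • u - (1 - 0 : ℝ) • v ≠ 0 := by simpa using hv.ne_zero
    have hsp := hsphere 0 hs0
    have hne : interpDirection u v 0 ≠ 0 := by
      rintro h; rw [h] at hsp; simp at hsp
    obtain ⟨r, hr, hKr⟩ := hK.exists_marginalLaw_eq_of_dim_one hK0 hθ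
    obtain ⟨r', hr', hTr⟩ :=
      (isConvexBody_solidSimplex T).exists_marginalLaw_eq_of_dim_one hT0 hne
    have hlaw : marginalLaw K θ =
        marginalLaw (solidSimplex T) ((r / r') • interpDirection u v 0) := by
      rw [marginalLaw_smul, hTr, map_mul_cond_Icc (by positivity), hKr,
        div_mul_cancel₀ _ hr'.ne']
    have hpos : ∀ p' : ℝ, 0 ≤ p' → bodyMoment p' K θ =
        bodyMoment p' (solidSimplex T) ((r / r') • interpDirection u v 0) := fun p' hp' => by
      rw [bodyMoment_eq_integral_marginalLaw hp', hlaw, bodyMoment_eq_integral_marginalLaw hp']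
    have hneg : ∀ p' : ℝ, 0 ≤ p' → bodyMoment p' K (-θ) =
        bodyMoment p' (solidSimplex T) (-((r / r') • interpDirection u v 0)) := fun p' hp' => by
      rw [bodyMoment_neg_eq_integral_marginalLaw hp', hlaw,
        bodyMoment_neg_eq_integral_marginalLaw hp']
    exact ⟨0, by simp, r / r', by positivity, hsp, hpos p (by linarith), hneg p (by linarith),
      (hpos q (by linarith)).le, (hneg q (by linarith)).le, fun _ _ => hlaw⟩
  · obtain ⟨s, hs, c, hc, hpos, hneg⟩ := exists_matching_direction hk hK hK0 hT0 hθ hij hu hv hp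
    have hne := hu.sub_ne_zero (by omega) hij hv s
    obtain ⟨m, hm⟩ := hu.exists_isTentDirection hij hv hs
    have hnorm : 0 < ‖s • u - (1 - s) • v‖ := norm_pos_iff.2 hne
    have e : (c * ‖s • u - (1 - s) • v‖) • interpDirection u v s = c • (s • u - (1 - s) • v) := by
      rw [interpDirection, smul_smul, mul_assoc, mul_inv_cancel₀ hnorm.ne', mul_one]
    refine ⟨s, hs, c * ‖s • u - (1 - s) • v‖, by positivity, hsphere s hne, ?_⟩
    rw [e]
    exact ⟨hpos, hneg, hK.bodyMoment_le hK0 hT0 hk hθ (smul_ne_zero hc.ne' hne)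
      (hm.smul hc.le) hp hpq hpos hneg⟩

end Main

/-! ### Norm ratios, attainment and conclusion -/

section NormRatio

variable {n : ℕ} {K : Set (EuclideanSpace ℝ (Fin n))} {θ : EuclideanSpace ℝ (Fin n)} {p q : ℝ}

lemma IsConvexBody.bodyMoment_add (hK : IsConvexBody K) (θ : EuclideanSpace ℝ (Fin n))
    (hp : 0 < p) : bodyMoment p K θ + bodyMoment p K (-θ) =
      ∫ x, |inner ℝ x θ| ^ p ∂(uniformLaw K) := by
  have hc := IsCenteredPowDensity.continuous_posPart_rpow hp.le
  have h1 : Integrable (fun x => max (inner ℝ x θ) 0 ^ p) (uniformLaw K) :=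
    hK.integrable_uniformLaw (hc.comp (f := fun x => inner ℝ x θ) (by fun_prop))
  have h2 : Integrable (fun x => max (inner ℝ x (-θ)) 0 ^ p) (uniformLaw K) :=
    hK.integrable_uniformLaw (hc.comp (f := fun x => inner ℝ x (-θ)) (by fun_prop))
  rw [bodyMoment, bodyMoment, ← integral_add h1 h2]
  congr 1; ext x
  rw [inner_neg_right]
  rcases le_total 0 (inner ℝ x θ) with h | h
  · rw [max_eq_left h, max_eq_right (by linarith), Real.zero_rpow hp.ne', abs_of_nonneg h, add_zero]
  · rw [max_eq_right h, max_eq_left (by linarith), Real.zero_rpow hp.ne', abs_of_nonpos h, zero_add]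

lemma IsConvexBody.toReal_eLpNorm (hK : IsConvexBody K) (θ : EuclideanSpace ℝ (Fin n))
    (hp : 0 < p) : (eLpNorm (fun x => inner ℝ x θ) (ENNReal.ofReal p) (uniformLaw K)).toReal =
      (bodyMoment p K θ + bodyMoment p K (-θ)) ^ p⁻¹ := by
  have hc : Continuous fun x : EuclideanSpace ℝ (Fin n) => inner ℝ x θ := by fun_prop
  have hmem : MemLp (fun x => inner ℝ x θ) (ENNReal.ofReal p) (uniformLaw K) := by
    rw [← integrable_norm_rpow_iff hc.aestronglyMeasurable (by simpa using hp)
      ENNReal.ofReal_ne_top, ENNReal.toReal_ofReal hp.le]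
    exact hK.integrable_uniformLaw (hc.norm.rpow_const fun _ => Or.inr hp.le)
  rw [hK.bodyMoment_add θ hp, hmem.eLpNorm_eq_integral_rpow_norm (by simpa using hp)
    ENNReal.ofReal_ne_top, ENNReal.toReal_ofReal hp.le, ENNReal.toReal_ofReal]
  · simp only [Real.norm_eq_abs]
  · positivity

lemma IsConvexBody.normRatio_eq (hK : IsConvexBody K) (θ : EuclideanSpace ℝ (Fin n))
    (hp : 0 < p) (hq : 0 < q) : normRatio p q K θ =
      (bodyMoment q K θ + bodyMoment q K (-θ)) ^ q⁻¹ /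
        (bodyMoment p K θ + bodyMoment p K (-θ)) ^ p⁻¹ := by
  rw [normRatio, hK.toReal_eLpNorm θ hp, hK.toReal_eLpNorm θ hq]

lemma bodyMoment_nonneg (θ : EuclideanSpace ℝ (Fin n)) : 0 ≤ bodyMoment p K θ :=
  integral_nonneg fun _ => Real.rpow_nonneg (le_max_right _ _) _

/-- If the moment vanished, X would lie almost surely in the hyperplane orthogonal to θ, which has
volume zero. -/
lemma IsConvexBody.bodyMoment_add_pos (hK : IsConvexBody K) (hθ : θ ≠ 0) (hp : 0 < p) :
    0 < bodyMoment p K θ + bodyMoment p K (-θ) := by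
  have hprob := hK.isProbabilityMeasure
  refine lt_of_le_of_ne (add_nonneg (bodyMoment_nonneg θ) (bodyMoment_nonneg (-θ))) fun h => ?_
  have hc : Continuous fun x : EuclideanSpace ℝ (Fin n) => |inner ℝ x θ| ^ p :=
    (Continuous.abs (by fun_prop)).rpow_const fun _ => Or.inr hp.le
  rw [hK.bodyMoment_add θ hp, eq_comm, integral_eq_zero_iff_of_nonneg (fun x => by positivity)
    (hK.integrable_uniformLaw hc)] at h
  have h1 : ∀ᵐ x ∂(uniformLaw K), x ∈ (ℝ ∙ θ)ᗮ := by
    filter_upwards [h] with x hx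
    rw [Submodule.mem_orthogonal_singleton_iff_inner_left]
    simpa [Real.rpow_eq_zero_iff_of_nonneg, hp.ne'] using hx
  have h2 : volume ((ℝ ∙ θ)ᗮ : Set (EuclideanSpace ℝ (Fin n))) = 0 := by
    refine Measure.addHaar_submodule _ _ fun htop => hθ ?_
    have : θ ∈ (ℝ ∙ θ)ᗮ := htop ▸ Submodule.mem_top
    rw [Submodule.mem_orthogonal_singleton_iff_inner_left] at this
    exact inner_self_eq_zero.1 this
  have h3 : uniformLaw K ((ℝ ∙ θ)ᗮ : Set (EuclideanSpace ℝ (Fin n))) = 0 :=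
    cond_absolutelyContinuous h2
  have h4 : ∀ᵐ x ∂(uniformLaw K), False := by
    filter_upwards [h1, measure_eq_zero_iff_ae_notMem.1 h3] with x hx hx' using hx' hx
  exact IsProbabilityMeasure.ne_zero (uniformLaw K) (by simpa using h4)

lemma IsConvexBody.normRatio_smul (hK : IsConvexBody K) (hp : 0 < p) (hq : 0 < q) {c : ℝ}
    (hc : 0 < c) : normRatio p q K (c • θ) = normRatio p q K θ := by
  rw [hK.normRatio_eq _ hp hq, hK.normRatio_eq _ hp hq, ← smul_neg, bodyMoment_smul hc.le,
    bodyMoment_smul hc.le, bodyMoment_smul hc.le, bodyMoment_smul hc.le, ← mul_add, ← mul_add,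
    Real.mul_rpow (by positivity) (add_nonneg (bodyMoment_nonneg _) (bodyMoment_nonneg _)),
    Real.mul_rpow (by positivity) (add_nonneg (bodyMoment_nonneg _) (bodyMoment_nonneg _)),
    ← Real.rpow_mul hc.le, ← Real.rpow_mul hc.le, mul_inv_cancel₀ hp.ne', mul_inv_cancel₀ hq.ne',
    Real.rpow_one, mul_div_mul_left _ _ hc.ne']

/-- The ratio is continuous on the compact sphere, its denominator being positive there; n ≥ 1 makes
the sphere nonempty. -/
lemma IsConvexBody.isGreatest_alpha (hn : 1 ≤ n) (hK : IsConvexBody K) (hp : 0 < p) (hq : 0 < q) :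
    IsGreatest (normRatio p q K '' Metric.sphere 0 1) (alpha p q K) := by
  have hcont : ContinuousOn (normRatio p q K) (Metric.sphere 0 1) := by
    have hsum : ∀ {r : ℝ}, 0 < r →
        Continuous fun θ => (bodyMoment r K θ + bodyMoment r K (-θ)) ^ r⁻¹ :=
      fun {r} hr => ((hK.continuous_bodyMoment hr.le).add
        ((hK.continuous_bodyMoment hr.le).comp continuous_neg)).rpow_const
          fun _ => Or.inr (inv_nonneg.2 hr.le)
    refine (ContinuousOn.div (hsum hq).continuousOn (hsum hp).continuousOn ?_).congr
      fun θ _ => hK.normRatio_eq θ hp hq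
    intro θ hθ
    have hθ0 : θ ≠ 0 := by rintro rfl; simp at hθ
    exact (Real.rpow_pos_of_pos (hK.bodyMoment_add_pos hθ0 hp) _).ne'
  have : Nontrivial (EuclideanSpace ℝ (Fin n)) := by
    have : Nonempty (Fin n) := ⟨⟨0, hn⟩⟩
    infer_instance
  exact ((isCompact_sphere _ _).image_of_continuousOn hcont).isGreatest_sSup
    ((NormedSpace.sphere_nonempty.2 zero_le_one).image _)

/-- The normal is minus the normalized gradient of the i-th barycentric coordinate, which is 1 at
vertex i and 0 at the others. -/
lemma exists_isOuterUnitNormal (hn : 1 ≤ n) (T : Affine.Simplex ℝ (EuclideanSpace ℝ (Fin n)) n)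
    (i : Fin (n + 1)) : ∃ u, IsOuterUnitNormal T i u := by
  have htop : affineSpan ℝ (Set.range T.points) = ⊤ :=
    T.independent.affineSpan_eq_top_iff_card_eq_finrank_add_one.2 (by simp)
  let b : AffineBasis (Fin (n + 1)) ℝ (EuclideanSpace ℝ (Fin n)) := ⟨T.points, T.independent, htop⟩
  set f : EuclideanSpace ℝ (Fin n) →L[ℝ] ℝ := LinearMap.toContinuousLinearMap (b.coord i).linear
  set a := (InnerProductSpace.toDual ℝ (EuclideanSpace ℝ (Fin n))).symm f with ha
  have hcoord : ∀ x, inner ℝ x a = b.coord i x - b.coord i 0 := by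
    intro x
    rw [real_inner_comm, ha, InnerProductSpace.toDual_symm_apply]
    have := (b.coord i).linearMap_vsub x 0
    rw [vsub_eq_sub, sub_zero, vsub_eq_sub] at this
    exact this
  have hpi : b.coord i (T.points i) = 1 := b.coord_apply_eq i
  have hpl : ∀ l, l ≠ i → b.coord i (T.points l) = 0 := fun l hl => b.coord_apply_ne hl.symm
  have ha0 : a ≠ 0 := by
    intro h0
    obtain ⟨l, hl⟩ : ∃ l : Fin (n + 1), l ≠ i := by
      have : Nontrivial (Fin (n + 1)) := Fin.nontrivial_iff_two_le.2 (by omega)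
      exact exists_ne i
    have h1 := hcoord (T.points i)
    have h2 := hcoord (T.points l)
    rw [h0, inner_zero_right, hpi] at h1
    rw [h0, inner_zero_right, hpl l hl] at h2
    linarith
  have hnorm : 0 < ‖a‖ := norm_pos_iff.2 ha0
  refine ⟨-(‖a‖⁻¹ • a), ?_, ‖a‖⁻¹ * b.coord i 0, fun l hl => ?_, ?_⟩
  · rw [norm_neg, norm_smul, norm_inv, norm_norm, inv_mul_cancel₀ hnorm.ne']
  · rw [inner_neg_right, inner_smul_right, hcoord, hpl l hl]; ring
  · rw [inner_neg_right, inner_smul_right, hcoord, hpi]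
    have : 0 < ‖a‖⁻¹ := inv_pos.2 hnorm
    linarith

/-- Every norm ratio of a centered convex body is at most that of some tent marginal of a centered
simplex, with equality only if the laws agree up to scaling. -/
theorem exists_normRatio_le (hn : 1 ≤ n) (hp : 1 < p) (hpq : p < q)
    (hK : IsConvexBody K) (hK0 : IsCentered K)
    {T : Affine.Simplex ℝ (EuclideanSpace ℝ (Fin n)) n} (hT0 : IsCentered (solidSimplex T))
    {i j : Fin (n + 1)} {u v : EuclideanSpace ℝ (Fin n)} (hij : i ≠ j)
    (hu : IsOuterUnitNormal T i u) (hv : IsOuterUnitNormal T j v)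
    (hθ : θ ∈ Metric.sphere (0 : EuclideanSpace ℝ (Fin n)) 1) :
    ∃ s ∈ Set.Icc (0 : ℝ) 1, interpDirection u v s ∈ Metric.sphere 0 1 ∧
      normRatio p q K θ ≤ normRatio p q (solidSimplex T) (interpDirection u v s) ∧
      (normRatio p q K θ = normRatio p q (solidSimplex T) (interpDirection u v s) →
        ∃ c : ℝ, 0 < c ∧ marginalLaw K θ =
          (marginalLaw (solidSimplex T) (interpDirection u v s)).map fun t => c * t) := by
  have hp0 : 0 < p := by linarith
  have hq0 : 0 < q := by linarith
  have hT := isConvexBody_solidSimplex T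
  have hθ0 : θ ≠ 0 := by rintro rfl; simp at hθ
  obtain ⟨s, hs, c, hc, hsp, h1, h2, h3, h4, h5⟩ :=
    exists_dominating_marginal hn hp hpq hK hK0 hT0 hij hu hv hθ0
  have hpos := hK.bodyMoment_add_pos hθ0 hp0
  have hden := Real.rpow_pos_of_pos hpos p⁻¹
  have hKq := hK.bodyMoment_add_pos hθ0 hq0
  refine ⟨s, hs, hsp, ?_⟩
  rw [← hT.normRatio_smul hp0 hq0 hc, hT.normRatio_eq _ hp0 hq0, hK.normRatio_eq _ hp0 hq0,
    ← h1, ← h2]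
  refine ⟨by gcongr, fun heq => ⟨c, hc, ?_⟩⟩
  -- The denominators agree, so equal ratios give equal sums of q-half-moments; as each half is
  -- dominated, both are equal.
  · rw [div_left_inj' hden.ne', Real.rpow_left_inj hKq.le
      (add_nonneg (bodyMoment_nonneg _) (bodyMoment_nonneg _)) (inv_ne_zero hq0.ne')] at heq
    rw [h5 (by linarith) (by linarith), marginalLaw_smul]

end NormRatio

theorem theorem1 (n : ℕ) (hn : 1 ≤ n) (p q : ℝ) (hp : 1 < p) (hpq : p < q)
    (K : Set (EuclideanSpace ℝ (Fin n))) (hK : IsConvexBody K) (hK0 : IsCentered K)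
    (T : Affine.Simplex ℝ (EuclideanSpace ℝ (Fin n)) n) (hT0 : IsCentered (solidSimplex T)) :
    -- the maxima defining `α(K)` and `α(Δₙ)` are attained
    IsGreatest (normRatio p q K '' Metric.sphere 0 1) (alpha p q K) ∧
    IsGreatest (normRatio p q (solidSimplex T) '' Metric.sphere 0 1)
      (alpha p q (solidSimplex T)) ∧
    alpha p q K ≤ alpha p q (solidSimplex T) ∧
    -- the one-parameter family of simplex marginals contains a maximizer, and contains
    -- every maximizing marginal of every centered convex body up to positive scaling
    ∀ (i j : Fin (n + 1)) (u v : EuclideanSpace ℝ (Fin n)), i ≠ j →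
      IsOuterUnitNormal T i u → IsOuterUnitNormal T j v →
      (∃ s ∈ Set.Icc (0 : ℝ) 1,
        normRatio p q (solidSimplex T) (interpDirection u v s) = alpha p q (solidSimplex T)) ∧
      ∀ θ ∈ Metric.sphere (0 : EuclideanSpace ℝ (Fin n)) 1,
        normRatio p q K θ = alpha p q (solidSimplex T) →
        ∃ s ∈ Set.Icc (0 : ℝ) 1, ∃ c : ℝ, 0 < c ∧
          marginalLaw K θ =
            (marginalLaw (solidSimplex T) (interpDirection u v s)).map (fun t => c * t) := by
  have hT := isConvexBody_solidSimplex T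
  have hp0 : 0 < p := by linarith
  have hq0 : 0 < q := by linarith
  have hgK := hK.isGreatest_alpha hn hp0 hq0
  have hgT := hT.isGreatest_alpha hn hp0 hq0
  refine ⟨hgK, hgT, ?_, fun i j u v hij hu hv => ⟨?_, fun θ hθ h => ?_⟩⟩
  · obtain ⟨θ, hθ, h⟩ := hgK.1
    have : Nontrivial (Fin (n + 1)) := Fin.nontrivial_iff_two_le.2 (by omega)
    obtain ⟨i, j, hij⟩ := exists_pair_ne (Fin (n + 1))
    obtain ⟨u, hu⟩ := exists_isOuterUnitNormal hn T i
    obtain ⟨v, hv⟩ := exists_isOuterUnitNormal hn T j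
    obtain ⟨s, -, hsp, hle, -⟩ := exists_normRatio_le hn hp hpq hK hK0 hT0 hij hu hv hθ
    rw [← h]
    exact hle.trans (hgT.2 ⟨_, hsp, rfl⟩)
  -- The comparison applied to the simplex itself moves a maximizer into the one-parameter family.
  · obtain ⟨θ, hθ, h⟩ := hgT.1
    obtain ⟨s, hs, hsp, hle, -⟩ := exists_normRatio_le hn hp hpq hT hT0 hT0 hij hu hv hθ
    exact ⟨s, hs, le_antisymm (hgT.2 ⟨_, hsp, rfl⟩) (h ▸ hle)⟩
  · obtain ⟨s, hs, hsp, hle, heq⟩ := exists_normRatio_le hn hp hpq hK hK0 hT0 hij hu hv hθ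
    -- The dominating tent ratio cannot exceed the maximum already reached by K, so the equality
    -- case applies.
    exact ⟨s, hs, heq (le_antisymm hle (h ▸ hgT.2 ⟨_, hsp, rfl⟩))⟩
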